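/- **Setting.** Let $(\bar M,\bar g)$ be a semi-Riemannian manifold with Levi-Civita connection $\bar\nabla$. Let $\bar J$ be a bronze structure on it, i.e. a smooth $(1,1)$-tensor field with $\bar J^2=3\bar J+I$ and $\bar g(X,\bar JY)=\bar g(\bar JX,Y)$, such that $\bar\nabla\bar J=0$ (so $\bar M$ is locally bronze). Let $l,m$ be smooth functions on $\bar M$, not both identically zero, let $\eta$ be a smooth vector field with $\bar g(\eta,\eta)=1$, put $\theta(X)=\bar g(X,\eta)$, and let $$\bar\Omega_XY=\bar\nabla_XY+\theta(Y)\{lX+m\bar JX\}$$ be the associated $(l,m)$-type connection. Let $(M,S(TM),S(TM^\perp))$ be a lightlike immersed submanifold of $\bar M$: $\mathrm{Rad}\,TM=TM\cap TM^\perp$ is a smooth distribution of constant rank $r>0$, $TM=\mathrm{Rad}\,TM\perp S(TM)$ and $TM^\perp=\mathrm{Rad}\,TM\perp S(TM^\perp)$ with smooth subbundles $S(TM)$, $S(TM^\perp)$. Let $ltr(TM)$ be a lightlike transversal bundle, i.e. a smooth totally null complement of $\mathrm{Rad}\,TM$ in $(S(TM)\oplus S(TM^\perp))^\perp$, so that $T\bar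 M|_M=TM\oplus tr(TM)$ with $tr(TM)=ltr(TM)\perp S(TM^\perp)$. For $X\in TM$ let $fX$ and $wX$ be the tangential and the transversal part of $\bar JX$. Suppose that $M$ is screen generic: $\bar J(\mathrm{Rad}\,TM)=\mathrm{Rad}\,TM$; $B_o=\bar J(S(TM))\cap S(TM)$ is a non-degenerate smooth distribution; and $B'$ is a non-degenerate smooth distribution with $S(TM)=B_o\oplus B'$ such that $fY\in B'$ and $wY\in S(TM^\perp)$ for all $Y\in B'$. For $X\in\Gamma(TM)$, $Y\in \Gamma(S(TM))$ and $W\in\Gamma(S(TM^\perp))$, let $\Omega_XY$ be the tangential part of $\bar\Omega_XY$, let $\Omega_XY=\Omega^*_XY+\bar h^*(X,Y)$ be its decomposition with $\Omega^*_XY\in S(TM)$ and $\bar h^*(X,Y)\in \mathrm{Rad}\,TM$, and let $-\bar A_WX$ be the tangential part of $\bar\Omega_XW$. **Theorem.** The distribution $B'$ is integrable (i.e. $[Y,Z]\in\Gamma(B')$ for all $Y,Z\in\Gamma(B')$) if and only if for all $Y,Z\in\Gamma(B')$: (i) the vector field $$\Omega_Y^{*}fZ + \bar{A}_{wY}Z+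 3\Omega_Z^{*}Y - \Omega_Z^{*}fY - \bar{A}_{wZ}Y- 3\Omega_Y^{*}Z$$ has no component in $B_o$ with respect to $TM=B_o\oplus B'\oplus\mathrm{Rad}\,TM$; and (ii) for every $N\in ltr(TM)$, $$\bar g\big(\bar{A}_{wY}Z + \bar h^{*}(Y,fZ)+3\bar h^{*}(Z,Y),\,\bar JN\big)= \bar g\big(\bar{A}_{wZ}Y + \bar h^{*}(Z,fY)+3\bar h^{*}(Y,Z),\,\bar JN\big).$$ -/

import Mathlib

open scoped Manifold ContDiff Topology Bundle

noncomputable section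

namespace LightlikeGeometry

/-- The tangent space at `x` of a smooth manifold of dimension `d`. -/
abbrev Tan (d : ℕ) {M : Type*} [TopologicalSpace M] [ChartedSpace (EuclideanSpace ℝ (Fin d)) M]
    (x : M) : Type :=
  TangentSpace (𝓡 d) x

/-! ### Smooth sections and smooth subbundles -/

section Bundles

variable {k d : ℕ}
  {M : Type*} [TopologicalSpace M] [ChartedSpace (EuclideanSpace ℝ (Fin k)) M]
  [IsManifold (𝓡 k) ∞ M]
  {N : Type*} [TopologicalSpace N] [ChartedSpace (EuclideanSpace ℝ (Fin d)) N]
  [IsManifold (𝓡 d) ∞ N]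

/-- Smoothness on `U` of a section `V` of the pullback bundle `φ^* TN`, that is, of a vector field
along the map `φ : M → N`. -/
def SmoothAlongOn (φ : M → N) (V : ∀ x, Tan d (φ x)) (U : Set M) : Prop :=
  ContMDiffOn (𝓡 k) (𝓡 d).tangent ∞ (fun x => (⟨φ x, V x⟩ : TangentBundle (𝓡 d) N)) U

/-- A family of subspaces `D x` of `T_{φ x} N` is a smooth subbundle of rank `n` of `φ^* TN`:
it has a smooth frame of `n` sections in a neighbourhood of each point. -/
def IsSmoothSubbundle (φ : M → N) (n : ℕ) (D : ∀ x, Submodule ℝ (Tan d (φ x))) : Prop :=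
  ∀ x, ∃ U ∈ 𝓝 x, ∃ s : Fin n → ∀ y, Tan d (φ y),
    (∀ i, SmoothAlongOn (k := k) φ (s i) U) ∧
    ∀ y ∈ U, LinearIndependent ℝ (fun i => s i y) ∧
      Submodule.span ℝ (Set.range fun i => s i y) = D y

/-- A smooth distribution of rank `n` on `M`, that is, a smooth subbundle of `TM`. -/
def IsSmoothDistribution (n : ℕ) (D : ∀ x : M, Submodule ℝ (Tan k x)) : Prop :=
  IsSmoothSubbundle (k := k) (d := k) (fun x : M => x) n D

/-- `X ∈ Γ(D)`: a smooth vector field on `M` with values in the distribution `D`. -/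
def IsSectionOf (D : ∀ x : M, Submodule ℝ (Tan k x)) (X : ∀ x : M, Tan k x) : Prop :=
  SmoothAlongOn (k := k) (d := k) (fun x : M => x) X Set.univ ∧ ∀ x, X x ∈ D x

/-- A distribution `D` is integrable if `[X, Y] ∈ Γ(D)` for all `X, Y ∈ Γ(D)`. -/
def IsIntegrable (D : ∀ x : M, Submodule ℝ (Tan k x)) : Prop :=
  ∀ X Y : ∀ x : M, Tan k x, IsSectionOf D X → IsSectionOf D Y →
    ∀ x, VectorField.mlieBracket (𝓡 k) X Y x ∈ D x

end Bundles

/-! ### The ambient manifold -/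

section Ambient

variable {d : ℕ} {N : Type*} [TopologicalSpace N] [ChartedSpace (EuclideanSpace ℝ (Fin d)) N]
  [IsManifold (𝓡 d) ∞ N]

variable (d N) in
/-- A semi-Riemannian metric: a smooth symmetric nondegenerate `(0,2)`-tensor field of constant
index. The index at `x` is the largest dimension of a negative definite subspace of `T_x N`. -/
structure SemiRiemannianMetric where
  val : ∀ x : N, Tan d x →L[ℝ] Tan d x →L[ℝ] ℝ
  contMDiff : ContMDiff (𝓡 d)
    ((𝓡 d).prod 𝓘(ℝ, EuclideanSpace ℝ (Fin d) →L[ℝ] EuclideanSpace ℝ (Fin d) →L[ℝ] ℝ)) ∞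
    (fun x => Bundle.TotalSpace.mk'
      (EuclideanSpace ℝ (Fin d) →L[ℝ] EuclideanSpace ℝ (Fin d) →L[ℝ] ℝ) x (val x))
  symm : ∀ x u v, val x u v = val x v u
  nondegenerate : ∀ x u, (∀ v, val x u v = 0) → u = 0
  index : ℕ
  index_spec : ∀ x, IsGreatest
    {j : ℕ | ∃ W : Submodule ℝ (Tan d x), Module.finrank ℝ W = j ∧
      ∀ v ∈ W, v ≠ 0 → val x v v < 0} index

variable (d N) in
/-- A linear connection on `N`. `D Y x v` stands for `D_v Y` at `x`. -/
abbrev LinearConnection :=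
  CovariantDerivative (𝓡 d) (EuclideanSpace ℝ (Fin d)) (TangentSpace (𝓡 d) : N → Type _)

/-- `D` is the Levi-Civita connection of `g`: it is torsion free and `D g = 0`. -/
structure IsLeviCivita (g : SemiRiemannianMetric d N) (D : LinearConnection d N) : Prop where
  torsion_eq_zero : D.torsion = 0
  metric : ∀ (Y Z : ∀ x : N, TangentSpace (𝓡 d) x) (x : N),
    MDifferentiableAt (𝓡 d) (𝓡 d).tangent (fun y => (⟨y, Y y⟩ : TangentBundle (𝓡 d) N)) x →
    MDifferentiableAt (𝓡 d) (𝓡 d).tangent (fun y => (⟨y, Z y⟩ : TangentBundle (𝓡 d) N)) x → ∀ v : Tan d x,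
    mfderiv (𝓡 d) 𝓘(ℝ, ℝ) (fun y => g.val y (Y y) (Z y)) x v =
      g.val x (D Y x v) (Z x) + g.val x (Y x) (D Z x v)

/-- A bronze structure compatible with `g`: a smooth `(1,1)`-tensor field `J` with
`J² = 3 J + I` and `g(X, J Y) = g(J X, Y)`. -/
structure BronzeStructure (g : SemiRiemannianMetric d N) where
  J : ∀ x : N, Tan d x →L[ℝ] Tan d x
  contMDiff : ContMDiff (𝓡 d)
    ((𝓡 d).prod 𝓘(ℝ, EuclideanSpace ℝ (Fin d) →L[ℝ] EuclideanSpace ℝ (Fin d))) ∞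
    (fun x => Bundle.TotalSpace.mk'
      (EuclideanSpace ℝ (Fin d) →L[ℝ] EuclideanSpace ℝ (Fin d)) x (J x))
  sq : ∀ x v, J x (J x v) = (3 : ℝ) • J x v + v
  compatible : ∀ x u v, g.val x u (J x v) = g.val x (J x u) v

/-- `D J = 0`, that is, `D_X (J Y) = J (D_X Y)`. A bronze semi-Riemannian manifold is locally
bronze if this holds for its Levi-Civita connection `D`. -/
def BronzeStructure.IsParallel {g : SemiRiemannianMetric d N} (J : BronzeStructure g)
    (D : LinearConnection d N) : Prop :=
  ∀ (Y : ∀ x : N, TangentSpace (𝓡 d) x) (x : N),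
    MDifferentiableAt (𝓡 d) (𝓡 d).tangent (fun y => (⟨y, Y y⟩ : TangentBundle (𝓡 d) N)) x →
    ∀ v : Tan d x, D (fun y => J.J y (Y y)) x v = J.J x (D Y x v)

/-- The data of an `(l,m)`-type connection: smooth functions `l`, `m`, not both identically zero,
and a smooth unit spacelike vector field `η`. -/
structure LMData (g : SemiRiemannianMetric d N) where
  l : N → ℝ
  m : N → ℝ
  η : ∀ x : N, Tan d x
  l_smooth : ContMDiff (𝓡 d) 𝓘(ℝ, ℝ) ∞ l
  m_smooth : ContMDiff (𝓡 d) 𝓘(ℝ, ℝ) ∞ m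
  η_smooth : ContMDiff (𝓡 d) (𝓡 d).tangent ∞ (fun x => (⟨x, η x⟩ : TangentBundle (𝓡 d) N))
  lm_ne_zero : (l, m) ≠ (0, 0)
  η_unit : ∀ x, g.val x (η x) (η x) = 1

/-- The 1-form `θ(X) = g(X, η) = g(η, X)`. -/
def LMData.θ {g : SemiRiemannianMetric d N} (c : LMData g) (x : N) : Tan d x →L[ℝ] ℝ :=
  g.val x (c.η x)

/-- The `(l,m)`-type connection `Ω_X Y = D_X Y + θ(Y) (l X + m J X)` built from a connection `D`
(below, from the Levi-Civita connection). -/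
def lmConnection {g : SemiRiemannianMetric d N} (D : LinearConnection d N)
    (J : BronzeStructure g) (c : LMData g) : LinearConnection d N :=
  D.addOneForm fun x =>
    (c.θ x).smulRight (c.l x • ContinuousLinearMap.id ℝ (Tan d x) + c.m x • J.J x)

end Ambient

/-! ### Covariant derivatives along a map -/

section Along

variable {k d : ℕ}
  {M : Type*} [TopologicalSpace M] [ChartedSpace (EuclideanSpace ℝ (Fin k)) M]
  [IsManifold (𝓡 k) ∞ M]
  {N : Type*} [TopologicalSpace N] [ChartedSpace (EuclideanSpace ℝ (Fin d)) N]
  [IsManifold (𝓡 d) ∞ N]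

/-- The differential of `φ` at `x`. -/
abbrev dmap (φ : M → N) (x : M) : Tan k x →L[ℝ] Tan d (φ x) :=
  mfderiv (𝓡 k) (𝓡 d) φ x

/-- The connection `D` on `N` acting on vector fields `V` along `φ : M → N` (the pullback
connection on `φ^* TN`): `covAlong D φ V x v` is `D_v V`. With the frame `(e_i)` of `TN` given by
the preferred trivialization at `φ x` and `V = ∑ V^i (e_i ∘ φ)` near `x`, it is
`∑ dV^i(v) e_i + ∑ V^i(x) D_{dφ(v)} e_i`. If `V` is the restriction `Y ∘ φ` of a vector field `Y`
on `N`, this is `D_{dφ(v)} Y`. -/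
def covAlong (D : LinearConnection d N) (φ : M → N) (V : ∀ x, Tan d (φ x)) (x : M)
    (v : Tan k x) : Tan d (φ x) :=
  (trivializationAt (EuclideanSpace ℝ (Fin d)) (TangentSpace (𝓡 d)) (φ x)).symm (φ x)
    (mfderiv (𝓡 k) 𝓘(ℝ, EuclideanSpace ℝ (Fin d))
      (fun y => (trivializationAt (EuclideanSpace ℝ (Fin d)) (TangentSpace (𝓡 d)) (φ x)
        (⟨φ y, V y⟩ : TangentBundle (𝓡 d) N)).2) x v)
  + D (FiberBundle.extend (EuclideanSpace ℝ (Fin d)) (V x)) (φ x) (dmap (k := k) φ x v)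

end Along

/-! ### Lightlike submanifolds -/

section Submanifold

variable {k d : ℕ}
  {M : Type*} [TopologicalSpace M] [ChartedSpace (EuclideanSpace ℝ (Fin k)) M]
  [IsManifold (𝓡 k) ∞ M]
  {N : Type*} [TopologicalSpace N] [ChartedSpace (EuclideanSpace ℝ (Fin d)) N]
  [IsManifold (𝓡 d) ∞ N]

/-- The orthogonal complement in `T_x N` of a subspace. -/
def orth (g : SemiRiemannianMetric d N) {x : N} (W : Submodule ℝ (Tan d x)) :
    Submodule ℝ (Tan d x) where
  carrier := {u | ∀ w ∈ W, g.val x u w = 0}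
  zero_mem' := by intro w _; simp
  add_mem' := by
    intro a b ha hb w hw
    simp [ha w hw, hb w hw]
  smul_mem' := by
    intro c a ha w hw
    simp [ha w hw]

/-- The tangent space of the submanifold, as a subspace of the ambient tangent space. -/
def tangentRange (φ : M → N) (x : M) : Submodule ℝ (Tan d (φ x)) :=
  LinearMap.range (dmap (k := k) φ x).toLinearMap

/-- The image in the ambient tangent space of a subspace of the tangent space of `M`. -/
def push (φ : M → N) (x : M) (W : Submodule ℝ (Tan k x)) : Submodule ℝ (Tan d (φ x)) :=
  W.map (dmap (k := k) (d := d) φ x).toLinearMap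

/-- The radical `Rad TM = TM ∩ TM^⊥`, as a family of subspaces of the tangent spaces of `M`. -/
def radical (g : SemiRiemannianMetric d N) (φ : M → N) (x : M) : Submodule ℝ (Tan k x) :=
  (orth g (tangentRange (k := k) φ x)).comap (dmap (k := k) (d := d) φ x).toLinearMap

variable (k M) in
/-- A lightlike (immersed) submanifold `(M, S(TM), S(TM^⊥))` of `(N, g)` with a lightlike
transversal bundle `ltr(TM)`. -/
structure LightlikeSubmanifold (g : SemiRiemannianMetric d N) where
  φ : M → N
  smooth : ContMDiff (𝓡 k) (𝓡 d) ∞ φ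
  immersion : ∀ x, Function.Injective (dmap (k := k) (d := d) φ x)
  /-- the rank of the radical distribution -/
  r : ℕ
  r_pos : 0 < r
  radical_smooth : IsSmoothDistribution r (radical (k := k) g φ)
  /-- the screen distribution `S(TM)` -/
  S : ∀ x : M, Submodule ℝ (Tan k x)
  S_smooth : ∃ n, IsSmoothDistribution n S
  isCompl_radical_S : ∀ x, IsCompl (radical (k := k) g φ x) (S x)
  /-- the screen transversal bundle `S(TM^⊥)`, a complement of `Rad TM` in `TM^⊥` -/
  SP : ∀ x : M, Submodule ℝ (Tan d (φ x))
  SP_smooth : ∃ n, IsSmoothSubbundle (k := k) φ n SP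
  disjoint_radical_SP : ∀ x, Disjoint (push φ x (radical (k := k) g φ x)) (SP x)
  radical_sup_SP : ∀ x, push φ x (radical (k := k) g φ x) ⊔ SP x = orth g (tangentRange (k := k) φ x)
  /-- the lightlike transversal bundle `ltr(TM)`, a totally null complement of `Rad TM` in the
  orthogonal complement of `S(TM) ⊕ S(TM^⊥)` -/
  ltr : ∀ x : M, Submodule ℝ (Tan d (φ x))
  ltr_smooth : IsSmoothSubbundle (k := k) φ r ltr
  ltr_null : ∀ x, ∀ u ∈ ltr x, ∀ v ∈ ltr x, g.val (φ x) u v = 0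
  disjoint_radical_ltr : ∀ x, Disjoint (push φ x (radical (k := k) g φ x)) (ltr x)
  radical_sup_ltr : ∀ x, push φ x (radical (k := k) g φ x) ⊔ ltr x =
    orth g (push φ x (S x)) ⊓ orth g (SP x)
  /-- `TN` restricted to `M` is `TM ⊕ tr(TM)` with `tr(TM) = ltr(TM) ⊕ S(TM^⊥)` -/
  isCompl_tangent_tr : ∀ x, IsCompl (tangentRange (k := k) φ x) (ltr x ⊔ SP x)

namespace LightlikeSubmanifold

variable {g : SemiRiemannianMetric d N} (L : LightlikeSubmanifold k M g)

/-- The tangential part of an ambient vector, with respect to `TM ⊕ tr(TM)`. -/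
def tangPart (x : M) : Tan d (L.φ x) →ₗ[ℝ] Tan k x :=
  (LinearEquiv.ofInjective (dmap (k := k) (d := d) L.φ x).toLinearMap (L.immersion x)).symm.toLinearMap ∘ₗ
    (tangentRange (k := k) L.φ x).projectionOnto (L.ltr x ⊔ L.SP x) (L.isCompl_tangent_tr x)

/-- The transversal part of an ambient vector, with respect to `TM ⊕ tr(TM)`. -/
def trPart (x : M) (u : Tan d (L.φ x)) : Tan d (L.φ x) :=
  u - dmap (k := k) L.φ x (L.tangPart x u)

/-- The projection of `TM = Rad TM ⊕ S(TM)` onto `S(TM)`. -/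
def projS (x : M) : Tan k x →ₗ[ℝ] Tan k x :=
  (L.S x).projection (radical (k := k) g L.φ x) (L.isCompl_radical_S x).symm

/-- The projection of `TM = Rad TM ⊕ S(TM)` onto `Rad TM`. -/
def projRad (x : M) : Tan k x →ₗ[ℝ] Tan k x :=
  (radical (k := k) g L.φ x).projection (L.S x) (L.isCompl_radical_S x)

/-- `Ω_v Y`: the connection on `M` induced by the ambient connection `D`, that is, the tangential
part of `D_v Y`. -/
def induced (D : LinearConnection d N) (Y : ∀ x : M, Tan k x) (x : M) (v : Tan k x) : Tan k x :=
  L.tangPart x (covAlong D L.φ (fun y => dmap (k := k) L.φ y (Y y)) x v)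

/-- `Ω^*_v Y`, for `Y ∈ Γ(S(TM))`: the `S(TM)`-part of `Ω_v Y`. -/
def screenConn (D : LinearConnection d N) (Y : ∀ x : M, Tan k x) (x : M) (v : Tan k x) :
    Tan k x :=
  L.projS x (L.induced D Y x v)

/-- `h^*(v, Y)`, for `Y ∈ Γ(S(TM))`: the `Rad TM`-part of `Ω_v Y`. -/
def hStar (D : LinearConnection d N) (Y : ∀ x : M, Tan k x) (x : M) (v : Tan k x) : Tan k x :=
  L.projRad x (L.induced D Y x v)

/-- The shape operator `A_W v`, for a transversal field `W`: minus the tangential part of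
`D_v W`. -/
def shape (D : LinearConnection d N) (W : ∀ x : M, Tan d (L.φ x)) (x : M) (v : Tan k x) :
    Tan k x :=
  -L.tangPart x (covAlong D L.φ W x v)

/-- `f v`: the tangential part of `J v`. -/
def f (J : BronzeStructure g) (x : M) (v : Tan k x) : Tan k x :=
  L.tangPart x (J.J (L.φ x) (dmap (k := k) L.φ x v))

/-- `w v`: the transversal part of `J v`. -/
def w (J : BronzeStructure g) (x : M) (v : Tan k x) : Tan d (L.φ x) :=
  L.trPart x (J.J (L.φ x) (dmap (k := k) L.φ x v))

/-- `B_o = J(S(TM)) ∩ S(TM)`. -/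
def Bo (J : BronzeStructure g) (x : M) : Submodule ℝ (Tan k x) :=
  ((push L.φ x (L.S x)).map (J.J (L.φ x)).toLinearMap).comap (dmap (k := k) (d := d) L.φ x).toLinearMap ⊓ L.S x

/-- The metric induced on `M` is nondegenerate on the distribution `D`. -/
def NondegenerateOn (D : ∀ x : M, Submodule ℝ (Tan k x)) : Prop :=
  ∀ x, ∀ u ∈ D x,
    (∀ v ∈ D x, g.val (L.φ x) (dmap (k := k) L.φ x u) (dmap (k := k) L.φ x v) = 0) → u = 0

/-- `M` is a screen generic lightlike submanifold, with distributions `B_o` and `B'`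
(written `Bp`): `J(Rad TM) = Rad TM`; `B_o = J(S(TM)) ∩ S(TM)` is a nondegenerate distribution;
`B'` is a nondegenerate distribution with `S(TM) = B_o ⊕ B'`, and for `Y` in `B'` the tangential
and transversal parts of `J Y` lie in `B'` and in `S(TM^⊥)`. -/
structure IsScreenGeneric (J : BronzeStructure g) (Bp : ∀ x : M, Submodule ℝ (Tan k x)) :
    Prop where
  radical_invariant : ∀ x, (push L.φ x (radical (k := k) g L.φ x)).map (J.J (L.φ x)).toLinearMap =
    push L.φ x (radical (k := k) g L.φ x)
  Bo_smooth : ∃ n, IsSmoothDistribution n (L.Bo J)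
  Bo_nondegenerate : L.NondegenerateOn (L.Bo J)
  Bp_smooth : ∃ n, IsSmoothDistribution n Bp
  Bp_nondegenerate : L.NondegenerateOn Bp
  disjoint_Bo_Bp : ∀ x, Disjoint (L.Bo J x) (Bp x)
  Bo_sup_Bp : ∀ x, L.Bo J x ⊔ Bp x = L.S x
  f_mem : ∀ x, ∀ v ∈ Bp x, L.f J x v ∈ Bp x
  w_mem : ∀ x, ∀ v ∈ Bp x, L.w J x v ∈ L.SP x

variable {L} in
/-- `TM = B_o ⊕ (B' ⊕ Rad TM)`. -/
theorem IsScreenGeneric.isCompl_Bo {J : BronzeStructure g}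
    {Bp : ∀ x : M, Submodule ℝ (Tan k x)} (h : L.IsScreenGeneric J Bp) (x : M) :
    IsCompl (L.Bo J x) (Bp x ⊔ radical (k := k) g L.φ x) := by
  have hc := (L.isCompl_radical_S x).symm
  rw [← h.Bo_sup_Bp x] at hc
  refine ⟨(h.disjoint_Bo_Bp x).disjoint_sup_right_of_disjoint_sup_left hc.disjoint, ?_⟩
  rw [codisjoint_iff, ← sup_assoc]
  exact hc.sup_eq_top

variable {L} in
/-- The component in `B_o` of a tangent vector of `M`, for `TM = B_o ⊕ B' ⊕ Rad TM`. -/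
def IsScreenGeneric.projBo {J : BronzeStructure g}
    {Bp : ∀ x : M, Submodule ℝ (Tan k x)} (h : L.IsScreenGeneric J Bp) (x : M) :
    Tan k x →ₗ[ℝ] Tan k x :=
  (L.Bo J x).projection (Bp x ⊔ radical (k := k) g L.φ x) (h.isCompl_Bo x)

end LightlikeSubmanifold

end Submanifold

end LightlikeGeometry

end

/-! Differentiate `J Z = f Z + w Z` along `Y` and take tangential parts. Since `J` is parallel, Ω_Y
fZ − A_{wZ}Y is the tangential part of J∇_Y Z plus θ(JZ)(lY + m fY). Antisymmetrising in `Y` and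
`Z`, torsion-freeness turns the first term into f[Y,Z]. In the same way Ω_Y Z − Ω_Z Y is [Y,Z] plus
multiples of lY + m fY and lZ + m fZ. All these corrections lie in `B'`, because `f` preserves `B'`.
So the vector field of (i), with full induced derivatives in place of the screen ones, equals f[Y,Z]
− 3[Y,Z] modulo `B'` (`exists_structure_equation`).

The bronze equation gives J⁻¹ = J − 3, so fv − 3v is the tangential part of J⁻¹v. The operator f − 3
preserves each summand of TM = B_o ⊕ B' ⊕ Rad TM and is injective on `B_o` and on `Rad TM`. On the
radical this is seen by duality: g(J⁻¹ρ, Jn) = g(ρ, n) for n in `ltr`. As J(ltr) is orthogonal to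
S(TM), pairing with it isolates the radical component. Hence v lies in `B'` exactly when fv − 3v has
no `B_o` component and is orthogonal to J(ltr) (`mem_Bp_iff`).

Applied to v = [Y,Z], these two tests become (i) and (ii): the radical parts h* are invisible to the
`B_o` projection, and the screen parts Ω* to the pairing with J(ltr). The equivalence therefore
holds point by point (`mlieBracket_mem_iff`).

The analytic input is calculus for the pullback connection `covAlong`: additivity, commutation with
`J` (`covAlong_J`), the torsion identity (`covAlong_dmap_sub`), and differentiability of fY and wY
(`mdiffAlongAt_dmap_tangPart`), without which the derivative of JY could not be split. -/

noncomputable section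

namespace LightlikeGeometry

/-! ### Connections in the coordinates of a trivialization. -/

section Coordinates

variable {d : ℕ} {N : Type*} [TopologicalSpace N] [ChartedSpace (EuclideanSpace ℝ (Fin d)) N]
  [IsManifold (𝓡 d) ∞ N]

/-- The coordinates of the tangent vector `v` at `q` in the preferred trivialization at `p`. -/
def coord (p : N) {q : N} (v : Tan d q) : EuclideanSpace ℝ (Fin d) :=
  (trivializationAt (EuclideanSpace ℝ (Fin d)) (TangentSpace (𝓡 d)) p
    (⟨q, v⟩ : TangentBundle (𝓡 d) N)).2

/-- The coordinate isomorphism `coord p` at the point `p` itself. -/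
def coordEquiv (p : N) : Tan d p ≃L[ℝ] EuclideanSpace ℝ (Fin d) :=
  (trivializationAt (EuclideanSpace ℝ (Fin d)) (TangentSpace (𝓡 d)) p).continuousLinearEquivAt ℝ p
    (FiberBundle.mem_baseSet_trivializationAt' p)

theorem coordEquiv_apply (p : N) (v : Tan d p) : coordEquiv p v = coord p v := rfl

theorem eventually_mem_baseSet (p : N) : ∀ᶠ q in 𝓝 p,
    q ∈ (trivializationAt (EuclideanSpace ℝ (Fin d)) (TangentSpace (𝓡 d) : N → Type _) p).baseSet :=
  (trivializationAt (EuclideanSpace ℝ (Fin d)) (TangentSpace (𝓡 d) : N → Type _)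
    p).open_baseSet.mem_nhds (FiberBundle.mem_baseSet_trivializationAt' p)

variable {p q : N}

theorem continuousLinearMapAt_eq_coord (hq : q ∈ (trivializationAt (EuclideanSpace ℝ (Fin d))
    (TangentSpace (𝓡 d)) p).baseSet) (v : Tan d q) :
    (trivializationAt (EuclideanSpace ℝ (Fin d)) (TangentSpace (𝓡 d)) p).continuousLinearMapAt ℝ q v
      = coord p v := by
  rw [Bundle.Trivialization.continuousLinearMapAt_apply,
    Bundle.Trivialization.coe_linearMapAt_of_mem _ hq]
  rfl

theorem coord_add (hq : q ∈ (trivializationAt (EuclideanSpace ℝ (Fin d))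
    (TangentSpace (𝓡 d)) p).baseSet) (v w : Tan d q) :
    coord p (v + w) = coord p v + coord p w := by
  simp only [← continuousLinearMapAt_eq_coord hq, map_add]

theorem coord_smul (hq : q ∈ (trivializationAt (EuclideanSpace ℝ (Fin d))
    (TangentSpace (𝓡 d)) p).baseSet) (a : ℝ) (v : Tan d q) :
    coord p (a • v) = a • coord p v := by
  simp only [← continuousLinearMapAt_eq_coord hq, map_smul]

theorem coord_sum {ι : Type*} [Fintype ι] (hq : q ∈ (trivializationAt (EuclideanSpace ℝ (Fin d))
    (TangentSpace (𝓡 d)) p).baseSet) (v : ι → Tan d q) :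
    coord p (∑ i, v i) = ∑ i, coord p (v i) := by
  simp only [← continuousLinearMapAt_eq_coord hq, map_sum]

theorem coord_injective (hq : q ∈ (trivializationAt (EuclideanSpace ℝ (Fin d))
    (TangentSpace (𝓡 d)) p).baseSet) {v w : Tan d q} (h : coord p v = coord p w) : v = w := by
  have := ((trivializationAt (EuclideanSpace ℝ (Fin d)) (TangentSpace (𝓡 d))
    p).continuousLinearEquivAt ℝ q hq).injective
  exact this h

theorem coord_symm (hq : q ∈ (trivializationAt (EuclideanSpace ℝ (Fin d))
    (TangentSpace (𝓡 d)) p).baseSet) (e : EuclideanSpace ℝ (Fin d)) :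
    coord p ((trivializationAt (EuclideanSpace ℝ (Fin d)) (TangentSpace (𝓡 d)) p).symm q e :
      Tan d q) = e := by
  unfold coord
  rw [Bundle.Trivialization.apply_mk_symm _ hq]

theorem coord_extend (hq : q ∈ (trivializationAt (EuclideanSpace ℝ (Fin d))
    (TangentSpace (𝓡 d)) p).baseSet) (v : Tan d p) :
    coord p (FiberBundle.extend (EuclideanSpace ℝ (Fin d)) v q : Tan d q) = coord p v :=
  coord_symm hq _

theorem mdifferentiableAt_coord {σ : ∀ q : N, Tan d q}
    (hσ : MDifferentiableAt (𝓡 d) (𝓡 d).tangent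
      (fun q => (⟨q, σ q⟩ : TangentBundle (𝓡 d) N)) p) :
    MDifferentiableAt (𝓡 d) 𝓘(ℝ, EuclideanSpace ℝ (Fin d)) (fun q => coord p (σ q)) p :=
  (mdifferentiableAt_section (𝓡 d) σ).1 hσ

theorem mdifferentiableAt_extend (v : Tan d p) :
    MDifferentiableAt (𝓡 d) (𝓡 d).tangent (fun q => (⟨q,
      FiberBundle.extend (EuclideanSpace ℝ (Fin d)) v q⟩ : TangentBundle (𝓡 d) N)) p :=
  FiberBundle.mdifferentiableAt_extend (𝓡 d) (EuclideanSpace ℝ (Fin d)) v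

/-- The extension of a vector has constant coordinates near `p`, so it serves as a coordinate frame
field. -/
theorem mvfderiv_coord_extend (v : Tan d p) :
    mvfderiv (𝓡 d) (fun q => coord p (FiberBundle.extend (EuclideanSpace ℝ (Fin d)) v q :
      Tan d q)) p = 0 := by
  have h : (fun q => coord p (FiberBundle.extend (EuclideanSpace ℝ (Fin d)) v q : Tan d q))
      =ᶠ[𝓝 p] fun _ => coord p v := by
    filter_upwards [eventually_mem_baseSet (d := d) p] with q hq using coord_extend hq v
  rw [mvfderiv, h.mfderiv_eq, h.eq_of_nhds]
  exact mvfderiv_const _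

theorem mvfderiv_coord_add {σ σ' : ∀ q : N, Tan d q}
    (hσ : MDifferentiableAt (𝓡 d) (𝓡 d).tangent
      (fun q => (⟨q, σ q⟩ : TangentBundle (𝓡 d) N)) p)
    (hσ' : MDifferentiableAt (𝓡 d) (𝓡 d).tangent
      (fun q => (⟨q, σ' q⟩ : TangentBundle (𝓡 d) N)) p) :
    mvfderiv (𝓡 d) (fun q => coord p ((σ + σ') q)) p =
      mvfderiv (𝓡 d) (fun q => coord p (σ q)) p + mvfderiv (𝓡 d) (fun q => coord p (σ' q)) p := by
  have h : (fun q => coord p ((σ + σ') q)) =ᶠ[𝓝 p] fun q => coord p (σ q) + coord p (σ' q) := by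
    filter_upwards [eventually_mem_baseSet (d := d) p] with q hq using coord_add hq _ _
  rw [← mvfderiv_fun_add (mdifferentiableAt_coord hσ) (mdifferentiableAt_coord hσ')]
  rw [mvfderiv, h.mfderiv_eq, h.eq_of_nhds]
  rfl

theorem mvfderiv_coord_smul {f : N → ℝ} {σ : ∀ q : N, Tan d q}
    (hf : MDifferentiableAt (𝓡 d) 𝓘(ℝ, ℝ) f p)
    (hσ : MDifferentiableAt (𝓡 d) (𝓡 d).tangent
      (fun q => (⟨q, σ q⟩ : TangentBundle (𝓡 d) N)) p) :
    mvfderiv (𝓡 d) (fun q => coord p ((f • σ) q)) p =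
      f p • mvfderiv (𝓡 d) (fun q => coord p (σ q)) p +
        (mvfderiv (𝓡 d) f p).smulRight (coord p (σ p)) := by
  have h : (fun q => coord p ((f • σ) q)) =ᶠ[𝓝 p] fun q => f q • coord p (σ q) := by
    filter_upwards [eventually_mem_baseSet (d := d) p] with q hq using coord_smul hq _ _
  rw [← mvfderiv_fun_smul hf (mdifferentiableAt_coord hσ)]
  rw [mvfderiv, h.mfderiv_eq, h.eq_of_nhds]
  rfl

/-- A connection in the coordinates given by the preferred trivialization at `p`. -/
theorem connection_apply_eq (D : LinearConnection d N) (Y : ∀ q : N, Tan d q) (p : N)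
    (hY : MDifferentiableAt (𝓡 d) (𝓡 d).tangent
      (fun q => (⟨q, Y q⟩ : TangentBundle (𝓡 d) N)) p) (u : Tan d p) :
    D Y p u = (coordEquiv p).symm (mvfderiv (𝓡 d) (fun q => coord p (Y q)) p u) +
      D (FiberBundle.extend (EuclideanSpace ℝ (Fin d)) (Y p)) p u := by
  -- The Leibniz terms of the connection and of the coordinate derivative cancel in `Φ`. It is
  -- therefore tensorial and can be evaluated on the constant-coordinate extension of `Y p`.
  let Φ : (∀ q : N, Tan d q) → Tan d p := fun Y =>
    D Y p u - (coordEquiv p).symm (mvfderiv (𝓡 d) (fun q => coord p (Y q)) p u)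
  have hΦ : TensorialAt (𝓡 d) (EuclideanSpace ℝ (Fin d)) Φ p := by
    constructor
    · intro f σ hf hσ
      have h3 : D (f • σ) p u = f p • D σ p u + mvfderiv (𝓡 d) f p u • σ p :=
        congr($(D.isCovariantDerivativeOnUniv.leibniz hσ hf (x := p)) u)
      have h4 : (coordEquiv p).symm (coord p (σ p)) = σ p :=
        (coordEquiv p).symm_apply_apply (σ p)
      simp only [Φ, h3, mvfderiv_coord_smul hf hσ, _root_.add_apply,
        _root_.smul_apply, ContinuousLinearMap.smulRight_apply, map_add, map_smul, h4]
      module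
    · intro σ σ' hσ hσ'
      have h3 : D (σ + σ') p u = D σ p u + D σ' p u :=
        congr($(D.isCovariantDerivativeOnUniv.add hσ hσ' (x := p)) u)
      simp only [Φ, h3, mvfderiv_coord_add hσ hσ', _root_.add_apply, map_add]
      abel
  have := hΦ.pointwise hY (mdifferentiableAt_extend (Y p)) (FiberBundle.extend_apply_self _ _).symm
  simp only [Φ, mvfderiv_coord_extend, _root_.zero_apply, map_zero, sub_zero] at this
  rw [← this]; abel

/-- The sum of the two extensions takes the value v + w at `p` and has vanishing coordinate
derivative there, so `connection_apply_eq` identifies its derivative with that of the extension of v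
+ w. -/
theorem connection_extend_add (D : LinearConnection d N) (v w u : Tan d p) :
    D (FiberBundle.extend (EuclideanSpace ℝ (Fin d)) (v + w)) p u =
      D (FiberBundle.extend (EuclideanSpace ℝ (Fin d)) v) p u +
        D (FiberBundle.extend (EuclideanSpace ℝ (Fin d)) w) p u := by
  have hv := mdifferentiableAt_extend v
  have hw := mdifferentiableAt_extend w
  have h := congr($(D.isCovariantDerivativeOnUniv.add hv hw (x := p)) u)
  have h' := connection_apply_eq D _ p (mdifferentiableAt_add_section hv hw) u
  rw [mvfderiv_coord_add hv hw, mvfderiv_coord_extend, mvfderiv_coord_extend] at h'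
  simp only [Pi.add_apply, FiberBundle.extend_apply_self, add_zero,
    _root_.zero_apply, map_zero, zero_add] at h'
  exact h'.symm.trans h

end Coordinates
end LightlikeGeometry
end

/-! ### The pullback connection along a map and its compatibility with `J`. -/

noncomputable section

namespace LightlikeGeometry

section Along

variable {k d : ℕ}
  {M : Type*} [TopologicalSpace M] [ChartedSpace (EuclideanSpace ℝ (Fin k)) M]
  {N : Type*} [TopologicalSpace N] [ChartedSpace (EuclideanSpace ℝ (Fin d)) N]
  [IsManifold (𝓡 d) ∞ N]

/-- Differentiability at `x` of a vector field along `φ`. -/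
def MDiffAlongAt (φ : M → N) (V : ∀ x, Tan d (φ x)) (x : M) : Prop :=
  MDifferentiableAt (𝓡 k) (𝓡 d).tangent (fun x => (⟨φ x, V x⟩ : TangentBundle (𝓡 d) N)) x

variable {φ : M → N} {V W : ∀ x, Tan d (φ x)} {x : M}

theorem mdiffAlongAt_iff : MDiffAlongAt (k := k) φ V x ↔
    MDifferentiableAt (𝓡 k) (𝓡 d) φ x ∧
    MDifferentiableAt (𝓡 k) 𝓘(ℝ, EuclideanSpace ℝ (Fin d)) (fun y => coord (φ x) (V y)) x :=
  mdifferentiableAt_totalSpace (𝓡 d) _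

theorem MDiffAlongAt.eventually_mem_baseSet (hφ : MDifferentiableAt (𝓡 k) (𝓡 d) φ x) :
    ∀ᶠ y in 𝓝 x, φ y ∈ (trivializationAt (EuclideanSpace ℝ (Fin d))
      (TangentSpace (𝓡 d) : N → Type _) (φ x)).baseSet :=
  hφ.continuousAt (LightlikeGeometry.eventually_mem_baseSet (d := d) (φ x))

theorem MDiffAlongAt.coord_add_eventuallyEq (hφ : MDifferentiableAt (𝓡 k) (𝓡 d) φ x)
    (V W : ∀ x, Tan d (φ x)) :
    (fun y => coord (φ x) (V y + W y)) =ᶠ[𝓝 x]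
      fun y => coord (φ x) (V y) + coord (φ x) (W y) := by
  filter_upwards [eventually_mem_baseSet hφ] with y hy using coord_add hy _ _

theorem MDiffAlongAt.add (hV : MDiffAlongAt (k := k) φ V x) (hW : MDiffAlongAt (k := k) φ W x) :
    MDiffAlongAt (k := k) φ (fun y => V y + W y) x := by
  rw [mdiffAlongAt_iff] at *
  exact ⟨hV.1, (hV.2.add hW.2).congr_of_eventuallyEq (coord_add_eventuallyEq hV.1 V W)⟩

theorem MDiffAlongAt.smul {f : M → ℝ} (hf : MDifferentiableAt (𝓡 k) 𝓘(ℝ, ℝ) f x)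
    (hV : MDiffAlongAt (k := k) φ V x) :
    MDiffAlongAt (k := k) φ (fun y => f y • V y) x := by
  rw [mdiffAlongAt_iff] at *
  refine ⟨hV.1, (hf.smul hV.2).congr_of_eventuallyEq ?_⟩
  filter_upwards [eventually_mem_baseSet hV.1] with y hy using coord_smul hy _ _

theorem MDiffAlongAt.sub (hV : MDiffAlongAt (k := k) φ V x) (hW : MDiffAlongAt (k := k) φ W x) :
    MDiffAlongAt (k := k) φ (fun y => V y - W y) x := by
  have := hV.add (MDiffAlongAt.smul (f := fun _ => (-1 : ℝ)) mdifferentiableAt_const hW)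
  simpa only [neg_smul, one_smul, ← sub_eq_add_neg] using this

theorem covAlong_eq (D : LinearConnection d N) (φ : M → N) (V : ∀ x, Tan d (φ x)) (x : M)
    (v : Tan k x) : covAlong D φ V x v =
      (coordEquiv (φ x)).symm (mvfderiv (𝓡 k) (fun y => coord (φ x) (V y)) x v) +
      D (FiberBundle.extend (EuclideanSpace ℝ (Fin d)) (V x)) (φ x) (dmap (k := k) φ x v) := rfl

theorem covAlong_add (D : LinearConnection d N) (hV : MDiffAlongAt (k := k) φ V x)
    (hW : MDiffAlongAt (k := k) φ W x) (v : Tan k x) :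
    covAlong D φ (fun y => V y + W y) x v = covAlong D φ V x v + covAlong D φ W x v := by
  have h := MDiffAlongAt.coord_add_eventuallyEq (mdiffAlongAt_iff.1 hV).1 V W
  have h' : mvfderiv (𝓡 k) (fun y => coord (φ x) (V y + W y)) x =
      mvfderiv (𝓡 k) (fun y => coord (φ x) (V y)) x +
      mvfderiv (𝓡 k) (fun y => coord (φ x) (W y)) x := by
    rw [← mvfderiv_fun_add (mdiffAlongAt_iff.1 hV).2 (mdiffAlongAt_iff.1 hW).2,
      mvfderiv, h.mfderiv_eq, h.eq_of_nhds]
    rfl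
  rw [covAlong_eq, covAlong_eq, covAlong_eq, h', connection_extend_add, _root_.add_apply, map_add]
  abel

/-- The two connections differ by a tensor, which only sees the value of the extension at the base
point. -/
theorem covAlong_lmConnection {g : SemiRiemannianMetric d N} (D : LinearConnection d N)
    (J : BronzeStructure g) (c : LMData g) (φ : M → N) (V : ∀ x, Tan d (φ x)) (x : M)
    (v : Tan k x) :
    covAlong (lmConnection D J c) φ V x v = covAlong D φ V x v + c.θ (φ x) (V x) •
      (c.l (φ x) • dmap (k := k) φ x v + c.m (φ x) • J.J (φ x) (dmap (k := k) φ x v)) := by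
  rw [covAlong_eq, covAlong_eq]
  have : ∀ (Y : ∀ q : N, Tan d q) (p : N) (u : Tan d p), lmConnection D J c Y p u =
    D Y p u + c.θ p (Y p) • (c.l p • u + c.m p • J.J p u) := fun Y p u => rfl
  rw [this, FiberBundle.extend_apply_self, add_assoc]

theorem mvfderiv_clm_apply {k : ℕ} {M : Type*} [TopologicalSpace M]
    [ChartedSpace (EuclideanSpace ℝ (Fin k)) M] {x : M} {E F : Type*} [NormedAddCommGroup E]
    [NormedSpace ℝ E] [NormedAddCommGroup F] [NormedSpace ℝ F]
    {A : M → E →L[ℝ] F} {u : M → E}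
    (hA : MDifferentiableAt (𝓡 k) 𝓘(ℝ, E →L[ℝ] F) A x)
    (hu : MDifferentiableAt (𝓡 k) 𝓘(ℝ, E) u x) (v : TangentSpace (𝓡 k) x) :
    mvfderiv (𝓡 k) (fun y => A y (u y)) x v =
      mvfderiv (𝓡 k) A x v (u x) + A x (mvfderiv (𝓡 k) u x v) := by
  -- Both derivatives are retyped on the model space, so that the product rule for Fréchet
  -- derivatives applies.
  let A' : EuclideanSpace ℝ (Fin k) →L[ℝ] E →L[ℝ] F := mvfderiv (𝓡 k) A x
  let u' : EuclideanSpace ℝ (Fin k) →L[ℝ] E := mvfderiv (𝓡 k) u x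
  have h : HasMFDerivAt (𝓡 k) 𝓘(ℝ, F) (fun y => A y (u y)) x
      ((A x).comp u' + A'.flip (u x)) := by
    refine ⟨hA.continuousAt.clm_apply hu.continuousAt, ?_⟩
    have := HasFDerivWithinAt.clm_apply (c' := A') (u' := u') hA.hasMFDerivAt.2 hu.hasMFDerivAt.2
    simp only [writtenInExtChartAt, Function.comp_apply, extChartAt_to_inv] at this
    exact this
  have h2 : mvfderiv (𝓡 k) (fun y => A y (u y)) x = (A x).comp u' + A'.flip (u x) := h.mfderiv
  rw [h2]
  exact add_comm _ _

/-- The bronze structure in the coordinates given by the trivialization at `p`. -/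
def BronzeStructure.coordJ {g : SemiRiemannianMetric d N} (J : BronzeStructure g) (p q : N) :
    EuclideanSpace ℝ (Fin d) →L[ℝ] EuclideanSpace ℝ (Fin d) :=
  ContinuousLinearMap.inCoordinates (EuclideanSpace ℝ (Fin d)) (TangentSpace (𝓡 d) : N → Type _)
    (EuclideanSpace ℝ (Fin d)) (TangentSpace (𝓡 d) : N → Type _) p q p q (J.J q)

theorem BronzeStructure.mdifferentiableAt_coordJ {g : SemiRiemannianMetric d N}
    (J : BronzeStructure g) (p : N) : MDifferentiableAt (𝓡 d)
      𝓘(ℝ, EuclideanSpace ℝ (Fin d) →L[ℝ] EuclideanSpace ℝ (Fin d)) (J.coordJ p) p :=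
  ((mdifferentiableAt_hom_bundle _).1
    (J.contMDiff.contMDiffAt.mdifferentiableAt (x := p) (by simp))).2

theorem BronzeStructure.coord_J {g : SemiRiemannianMetric d N}
    (J : BronzeStructure g) {p q : N} (hq : q ∈ (trivializationAt (EuclideanSpace ℝ (Fin d))
    (TangentSpace (𝓡 d)) p).baseSet) (v : Tan d q) :
    coord p (J.J q v) = J.coordJ p q (coord p v) := by
  unfold coordJ
  rw [← continuousLinearMapAt_eq_coord hq, ← continuousLinearMapAt_eq_coord hq,
    ContinuousLinearMap.inCoordinates, ContinuousLinearMap.comp_apply,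
    ContinuousLinearMap.comp_apply, Bundle.Trivialization.symmL_continuousLinearMapAt _ hq]

theorem MDiffAlongAt.coord_J_eventuallyEq {g : SemiRiemannianMetric d N}
    (J : BronzeStructure g) (hφ : MDifferentiableAt (𝓡 k) (𝓡 d) φ x) (V : ∀ x, Tan d (φ x)) :
    (fun y => coord (φ x) (J.J (φ y) (V y))) =ᶠ[𝓝 x]
      fun y => J.coordJ (φ x) (φ y) (coord (φ x) (V y)) := by
  filter_upwards [eventually_mem_baseSet hφ] with y hy using J.coord_J hy _

theorem MDiffAlongAt.J {g : SemiRiemannianMetric d N}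
    (J : BronzeStructure g) (hV : MDiffAlongAt (k := k) φ V x) :
    MDiffAlongAt (k := k) φ (fun y => J.J (φ y) (V y)) x := by
  rw [mdiffAlongAt_iff] at *
  exact ⟨hV.1, (((J.mdifferentiableAt_coordJ (φ x)).comp x hV.1).clm_apply
    hV.2).congr_of_eventuallyEq (coord_J_eventuallyEq J hV.1 V)⟩

/-- Product rule. The term that differentiates `J` depends only on `V x` and dφ(v), so it is the
same for any other field through `V x`, in particular for one on `N`. -/
theorem mvfderiv_coord_J {g : SemiRiemannianMetric d N}
    (J : BronzeStructure g) (hV : MDiffAlongAt (k := k) φ V x) (v : Tan k x) :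
    mvfderiv (𝓡 k) (fun y => coord (φ x) (J.J (φ y) (V y))) x v =
      mvfderiv (𝓡 d) (J.coordJ (φ x)) (φ x) (dmap (k := k) φ x v) (coord (φ x) (V x)) +
      J.coordJ (φ x) (φ x) (mvfderiv (𝓡 k) (fun y => coord (φ x) (V y)) x v) := by
  rw [mdiffAlongAt_iff] at hV
  have h := MDiffAlongAt.coord_J_eventuallyEq J hV.1 V
  have h1 : mvfderiv (𝓡 k) (J.coordJ (φ x) ∘ φ) x v =
      mvfderiv (𝓡 d) (J.coordJ (φ x)) (φ x) (dmap (k := k) φ x v) :=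
    mfderiv_comp_apply x (J.mdifferentiableAt_coordJ (φ x)) hV.1 v
  rw [← h1]
  rw [mvfderiv, h.mfderiv_eq, h.eq_of_nhds]
  exact mvfderiv_clm_apply ((J.mdifferentiableAt_coordJ (φ x)).comp x hV.1) hV.2 v

/-- The pullback of a connection for which `J` is parallel commutes with `J`. -/
theorem covAlong_J {g : SemiRiemannianMetric d N} {J : BronzeStructure g}
    {D : LinearConnection d N} (hJ : J.IsParallel D) (hV : MDiffAlongAt (k := k) φ V x)
    (v : Tan k x) :
    covAlong D φ (fun y => J.J (φ y) (V y)) x v = J.J (φ x) (covAlong D φ V x v) := by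
  have hp := FiberBundle.mem_baseSet_trivializationAt' (F := EuclideanSpace ℝ (Fin d))
    (E := (TangentSpace (𝓡 d) : N → Type _)) (φ x)
  have hs : ∀ e, J.J (φ x) ((coordEquiv (φ x)).symm e) =
      (coordEquiv (φ x)).symm (J.coordJ (φ x) (φ x) e) := by
    intro e
    rw [ContinuousLinearEquiv.eq_symm_apply, coordEquiv_apply, J.coord_J hp, ← coordEquiv_apply,
      ContinuousLinearEquiv.apply_symm_apply]
  -- `V` need not extend to a field on `N`. Parallelism is used only for the constant-coordinate
  -- extension of `V x`, where it expresses the derivative of the matrix of `J` through the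
  -- connection terms.
  have he : MDiffAlongAt (k := d) (fun q : N => q)
    (FiberBundle.extend (EuclideanSpace ℝ (Fin d)) (V x)) (φ x) := mdifferentiableAt_extend (V x)
  have h1 := connection_apply_eq D _ (φ x) (he.J J) (dmap (k := k) φ x v)
  have h2 := mvfderiv_coord_J J he (dmap (k := k) φ x v)
  have h3 : dmap (k := d) (fun q : N => q) (φ x) (dmap (k := k) φ x v) = dmap (k := k) φ x v :=
    congr($(mfderiv_id (I := 𝓡 d) (x := φ x)) _)
  rw [mvfderiv_coord_extend, h3] at h2
  simp only [FiberBundle.extend_apply_self, _root_.zero_apply, map_zero, add_zero] at h2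
  rw [h2, hJ _ _ he] at h1
  rw [covAlong_eq, covAlong_eq, mvfderiv_coord_J J hV, map_add, map_add, hs, h1]
  simp only [FiberBundle.extend_apply_self]
  abel

end Along
end LightlikeGeometry
end

/-! ### Lie brackets and the torsion identity along a map. -/

noncomputable section

namespace LightlikeGeometry

section Bracket

theorem dmap_eq_fderiv {k d : ℕ}
    {M : Type*} [TopologicalSpace M] [ChartedSpace (EuclideanSpace ℝ (Fin k)) M]
    {N : Type*} [TopologicalSpace N] [ChartedSpace (EuclideanSpace ℝ (Fin d)) N] {φ : M → N}
    (hφ : ContMDiff (𝓡 k) (𝓡 d) ∞ φ) (x : M) (v : Tan k x) :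
    dmap (k := k) (d := d) φ x v =
      fderiv ℝ (writtenInExtChartAt (𝓡 k) (𝓡 d) x φ) (extChartAt (𝓡 k) x x) v := by
  have h := (hφ.mdifferentiable (by simp) x).mfderiv
  rw [dmap, h, ← fderivWithin_univ]
  have hr : Set.range (𝓡 k) = Set.univ := by simp
  rw [hr]
  rfl

theorem contDiffAt_writtenInExtChartAt {k d : ℕ}
    {M : Type*} [TopologicalSpace M] [ChartedSpace (EuclideanSpace ℝ (Fin k)) M]
    {N : Type*} [TopologicalSpace N] [ChartedSpace (EuclideanSpace ℝ (Fin d)) N] {φ : M → N}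
    (hφ : ContMDiff (𝓡 k) (𝓡 d) ∞ φ) (x : M) :
    ContDiffAt ℝ ∞ (writtenInExtChartAt (𝓡 k) (𝓡 d) x φ) (extChartAt (𝓡 k) x x) := by
  have := (contMDiffAt_iff.1 (hφ x)).2
  simpa [contDiffWithinAt_univ, writtenInExtChartAt] using! this

variable {k d : ℕ}
  {M : Type*} [TopologicalSpace M] [ChartedSpace (EuclideanSpace ℝ (Fin k)) M]
  [IsManifold (𝓡 k) ∞ M]
  {N : Type*} [TopologicalSpace N] [ChartedSpace (EuclideanSpace ℝ (Fin d)) N]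
  [IsManifold (𝓡 d) ∞ N]

/-- The vector field `V` in the preferred chart at `x`. -/
def chartField (V : ∀ y : M, Tan k y) (x : M) : EuclideanSpace ℝ (Fin k) →
    EuclideanSpace ℝ (Fin k) :=
  VectorField.mpullbackWithin 𝓘(ℝ, EuclideanSpace ℝ (Fin k)) (𝓡 k) (extChartAt (𝓡 k) x).symm V
    (Set.range (𝓡 k))

variable {V Y Z : ∀ y : M, Tan k y} {x : M} {φ : M → N}

theorem differentiableAt_chartField (hV : MDifferentiableAt (𝓡 k) (𝓡 k).tangent
      (fun y => (⟨y, V y⟩ : TangentBundle (𝓡 k) M)) x) :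
    DifferentiableAt ℝ (chartField V x) (extChartAt (𝓡 k) x x) := by
  have : DifferentiableWithinAt ℝ (chartField V x) _ _ := (mdifferentiableWithinAt_univ.2
    hV).differentiableWithinAt_mpullbackWithin_vectorField
  have hr : (extChartAt (𝓡 k) x).symm ⁻¹' Set.univ ∩ Set.range (𝓡 k) = Set.univ := by simp
  rw [hr, differentiableWithinAt_univ] at this
  exact this

theorem chartField_self (V : ∀ y : M, Tan k y) (x : M) :
    chartField V x (extChartAt (𝓡 k) x x) = V x := by
  -- The chart round trip returns `x` only propositionally, so the base point is generalised before
  -- substituting.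
  have h : ∀ y, y = x → (mfderivWithin 𝓘(ℝ, EuclideanSpace ℝ (Fin k)) (𝓡 k)
    (extChartAt (𝓡 k) x).symm (Set.range (𝓡 k)) (extChartAt (𝓡 k) x x)).inverse (V y) = V x := by
    rintro y rfl
    exact mfderivWithin_extChartAt_symm_inverse_apply _
  exact h _ (extChartAt_to_inv x)

theorem mfderivWithin_chartField (V : ∀ y : M, Tan k y) {e : EuclideanSpace ℝ (Fin k)}
    (he : e ∈ (extChartAt (𝓡 k) x).target) :
    mfderivWithin 𝓘(ℝ, EuclideanSpace ℝ (Fin k)) (𝓡 k) (extChartAt (𝓡 k) x).symm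
      (Set.range (𝓡 k)) e (chartField V x e) = V ((extChartAt (𝓡 k) x).symm e) := by
  have h := isInvertible_mfderivWithin_extChartAt_symm he
  exact h.self_apply_inverse (V ((extChartAt (𝓡 k) x).symm e))

/-- The bracket is defined by pulling back to the chart at `x`, whose differential at `x` is the
identity. -/
theorem mlieBracket_eq_chartField (Y Z : ∀ y : M, Tan k y) (x : M) :
    VectorField.mlieBracket (𝓡 k) Y Z x =
      fderiv ℝ (chartField Z x) (extChartAt (𝓡 k) x x) (Y x) -
      fderiv ℝ (chartField Y x) (extChartAt (𝓡 k) x x) (Z x) := by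
  have hid : ∀ w : Tan k x, (mfderiv (𝓡 k) 𝓘(ℝ, EuclideanSpace ℝ (Fin k))
      (extChartAt (𝓡 k) x) x).inverse w = w := by
    intro w
    rw [mfderiv_extChartAt_self]
    exact congr($(ContinuousLinearMap.inverse_id) w)
  have hr : (extChartAt (𝓡 k) x).symm ⁻¹' Set.univ ∩ Set.range (𝓡 k) = Set.univ := by simp
  have h : VectorField.lieBracketWithin ℝ (chartField Y x) (chartField Z x)
      ((extChartAt (𝓡 k) x).symm ⁻¹' Set.univ ∩ Set.range (𝓡 k)) (extChartAt (𝓡 k) x x) =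
      fderiv ℝ (chartField Z x) (extChartAt (𝓡 k) x x) (Y x) -
      fderiv ℝ (chartField Y x) (extChartAt (𝓡 k) x x) (Z x) := by
    rw [hr, VectorField.lieBracketWithin, fderivWithin_univ, fderivWithin_univ,
      chartField_self, chartField_self]
  exact (hid _).trans h

theorem coord_self {p : N} (v : Tan d p) : coord p v = v := by
  rw [← continuousLinearMapAt_eq_coord (FiberBundle.mem_baseSet_trivializationAt' p),
    TangentBundle.continuousLinearMapAt_trivializationAt (by simp), mfderiv_extChartAt_self]
  rfl

/-- The differential of `φ` in coordinates. -/
theorem coord_dmap_eventuallyEq (hφ : ContMDiff (𝓡 k) (𝓡 d) ∞ φ) (V : ∀ y : M, Tan k y) (x : M) :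
    (fun y => coord (φ x) (dmap (k := k) φ y (V y))) =ᶠ[𝓝 x]
      (fun e => fderiv ℝ (writtenInExtChartAt (𝓡 k) (𝓡 d) x φ) e (chartField V x e)) ∘
        extChartAt (𝓡 k) x := by
  have h1 : ∀ᶠ y in 𝓝 x, φ y ∈ (chartAt (EuclideanSpace ℝ (Fin d)) (φ x)).source :=
    hφ.continuous.continuousAt ((chartAt (EuclideanSpace ℝ (Fin d)) (φ x)).open_source.mem_nhds
      (mem_chart_source _ _))
  have h2 : ∀ᶠ y in 𝓝 x, y ∈ (extChartAt (𝓡 k) x).source :=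
    extChartAt_source_mem_nhds x
  filter_upwards [h1, h2] with y hy1 hy2
  -- The trivialization at φ x is the differential of the chart there, so in the chart at `x` the
  -- claim is the chain rule for chart ∘ φ ∘ chart⁻¹.
  have key : ∀ e ∈ (extChartAt (𝓡 k) x).target,
      φ ((extChartAt (𝓡 k) x).symm e) ∈ (chartAt (EuclideanSpace ℝ (Fin d)) (φ x)).source →
      coord (φ x) (dmap (k := k) φ ((extChartAt (𝓡 k) x).symm e)
        (V ((extChartAt (𝓡 k) x).symm e))) =
      fderiv ℝ (writtenInExtChartAt (𝓡 k) (𝓡 d) x φ) e (chartField V x e) := by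
    intro e he hs
    have hb : φ ((extChartAt (𝓡 k) x).symm e) ∈ (trivializationAt (EuclideanSpace ℝ (Fin d))
      (TangentSpace (𝓡 d) : N → Type _) (φ x)).baseSet := hs
    rw [← continuousLinearMapAt_eq_coord hb,
      TangentBundle.continuousLinearMapAt_trivializationAt hs, ← mfderivWithin_chartField V he]
    have a1 := (mdifferentiableWithinAt_extChartAt_symm he).hasMFDerivWithinAt
    have a2 := (hφ.mdifferentiable (by simp) ((extChartAt (𝓡 k) x).symm e)).hasMFDerivAt
    have a3 := (mdifferentiableAt_extChartAt (I := 𝓡 d) hs).hasMFDerivAt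
    have a4 := (a3.comp_hasMFDerivWithinAt e (a2.comp_hasMFDerivWithinAt e a1))
    have a5 := a4.hasMFDerivAt (by simp)
    exact congr($((mfderiv_eq_fderiv.symm.trans a5.mfderiv).symm) (chartField V x e))
  have hl := (extChartAt (𝓡 k) x).left_inv hy2
  have := key (extChartAt (𝓡 k) x y) ((extChartAt (𝓡 k) x).map_source hy2) (by rwa [hl])
  rw [← Function.comp_apply (f := fun e => fderiv ℝ _ e _)] at this
  rw [← this, hl]

theorem mvfderiv_coord_dmap (hφ : ContMDiff (𝓡 k) (𝓡 d) ∞ φ)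
    (hV : MDifferentiableAt (𝓡 k) (𝓡 k).tangent
      (fun y => (⟨y, V y⟩ : TangentBundle (𝓡 k) M)) x) (v : Tan k x) :
    mvfderiv (𝓡 k) (fun y => coord (φ x) (dmap (k := k) φ y (V y))) x v =
      fderiv ℝ (fderiv ℝ (writtenInExtChartAt (𝓡 k) (𝓡 d) x φ)) (extChartAt (𝓡 k) x x) v (V x) +
      fderiv ℝ (writtenInExtChartAt (𝓡 k) (𝓡 d) x φ) (extChartAt (𝓡 k) x x)
        (fderiv ℝ (chartField V x) (extChartAt (𝓡 k) x x) v) := by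
  have h := coord_dmap_eventuallyEq hφ V x
  have hF := ((contDiffAt_writtenInExtChartAt hφ x).fderiv_right (m := 1)
    (by simpa [one_add_one_eq_two] using ENat.LEInfty.out)).differentiableAt (by simp)
  have hG := hF.hasFDerivAt.clm_apply (differentiableAt_chartField hV).hasFDerivAt
  have hχ : MDifferentiableAt (𝓡 k) 𝓘(ℝ, EuclideanSpace ℝ (Fin k)) (extChartAt (𝓡 k) x) x :=
    mdifferentiableAt_extChartAt (mem_chart_source _ x)
  have h1 := mfderiv_comp_apply x hG.differentiableAt.mdifferentiableAt hχ v
  rw [mfderiv_extChartAt_self, mfderiv_eq_fderiv, hG.fderiv] at h1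
  rw [mvfderiv, h.mfderiv_eq, ← chartField_self V x, add_comm]
  exact h1

/-- The bracket of vector fields on `M` in terms of the coordinates of a map `φ`. -/
theorem mvfderiv_coord_dmap_sub (hφ : ContMDiff (𝓡 k) (𝓡 d) ∞ φ)
    (hY : MDifferentiableAt (𝓡 k) (𝓡 k).tangent
      (fun y => (⟨y, Y y⟩ : TangentBundle (𝓡 k) M)) x)
    (hZ : MDifferentiableAt (𝓡 k) (𝓡 k).tangent
      (fun y => (⟨y, Z y⟩ : TangentBundle (𝓡 k) M)) x) :
    mvfderiv (𝓡 k) (fun y => coord (φ x) (dmap (k := k) (d := d) φ y (Z y))) x (Y x) -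
      mvfderiv (𝓡 k) (fun y => coord (φ x) (dmap (k := k) (d := d) φ y (Y y))) x (Z x) =
      coord (φ x) (dmap (k := k) (d := d) φ x (VectorField.mlieBracket (𝓡 k) Y Z x)) := by
  -- The second derivative of φ is symmetric and cancels on antisymmetrising; the first derivative
  -- of φ applied to the bracket remains.
  have hs := (contDiffAt_writtenInExtChartAt hφ x).isSymmSndFDerivAt
    (by simpa using ENat.LEInfty.out) (Y x) (Z x)
  rw [mvfderiv_coord_dmap hφ hY, mvfderiv_coord_dmap hφ hZ, mlieBracket_eq_chartField, coord_self]
  refine Eq.trans ?_ (dmap_eq_fderiv hφ x _).symm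
  refine Eq.trans ?_ (map_sub (fderiv ℝ (writtenInExtChartAt (𝓡 k) (𝓡 d) x φ)
    (extChartAt (𝓡 k) x x)) _ _).symm
  rw [hs]
  abel

/-- Along a map, the torsion-free condition reads `D_Y dφ(Z) - D_Z dφ(Y) = dφ[Y, Z]`. -/
theorem covAlong_dmap_sub {D : LinearConnection d N} (hD : D.torsion = 0)
    (hφ : ContMDiff (𝓡 k) (𝓡 d) ∞ φ)
    (hY : MDifferentiableAt (𝓡 k) (𝓡 k).tangent
      (fun y => (⟨y, Y y⟩ : TangentBundle (𝓡 k) M)) x)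
    (hZ : MDifferentiableAt (𝓡 k) (𝓡 k).tangent
      (fun y => (⟨y, Z y⟩ : TangentBundle (𝓡 k) M)) x) :
    covAlong D φ (fun y => dmap (k := k) φ y (Z y)) x (Y x) -
      covAlong D φ (fun y => dmap (k := k) φ y (Y y)) x (Z x) =
      dmap (k := k) φ x (VectorField.mlieBracket (𝓡 k) Y Z x) := by
  have ht := fun {U V : ∀ q : N, Tan d q} {q : N} => (D.torsion_eq_zero_iff.1 hD (X := U) (Y := V)
    (x := q))
  -- Symmetry of the Christoffel symbols: the bracket of two constant-coordinate fields vanishes at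
  -- φ x, by the preceding bracket formula applied to the identity of `N`.
  have he : ∀ v w : Tan d (φ x),
      D (FiberBundle.extend (EuclideanSpace ℝ (Fin d)) w) (φ x) v -
      D (FiberBundle.extend (EuclideanSpace ℝ (Fin d)) v) (φ x) w = 0 := by
    intro v w
    have h1 := ht (mdifferentiableAt_extend v) (mdifferentiableAt_extend w)
    have h2 := mvfderiv_coord_dmap_sub (φ := fun q : N => q) contMDiff_id
      (mdifferentiableAt_extend v) (mdifferentiableAt_extend w)
    have h3 : ∀ (q : N) (u : Tan d q), dmap (k := d) (fun q : N => q) q u = u := fun q u =>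
      congr($(mfderiv_id (I := 𝓡 d) (x := q)) _)
    simp only [h3, mvfderiv_coord_extend, _root_.zero_apply, sub_self, coord_self] at h2
    simp only [FiberBundle.extend_apply_self] at h1
    rw [h1]
    exact h2.symm
  have h := mvfderiv_coord_dmap_sub (d := d) hφ hY hZ
  have h' : dmap (k := k) φ x (VectorField.mlieBracket (𝓡 k) Y Z x) = (coordEquiv (φ x)).symm
    (coord (φ x) (dmap (k := k) (d := d) φ x (VectorField.mlieBracket (𝓡 k) Y Z x))) :=
    ((coordEquiv (φ x)).symm_apply_apply _).symm
  rw [h', ← h, map_sub, covAlong_eq, covAlong_eq,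
    sub_eq_zero.1 (he (dmap (k := k) φ x (Y x)) (dmap (k := k) φ x (Z x)))]
  abel

end Bracket
end LightlikeGeometry
end

/-! ### Differentiable coefficients in a spanning family. -/

noncomputable section

namespace LightlikeGeometry

section Frames

theorem mdifferentiableAt_fun_sum {k : ℕ} {M : Type*} [TopologicalSpace M]
    [ChartedSpace (EuclideanSpace ℝ (Fin k)) M] {x : M} {E : Type*} [NormedAddCommGroup E]
    [NormedSpace ℝ E] {ι : Type} [Fintype ι] {u : ι → M → E}
    (hu : ∀ i, MDifferentiableAt (𝓡 k) 𝓘(ℝ, E) (u i) x) :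
    MDifferentiableAt (𝓡 k) 𝓘(ℝ, E) (fun y => ∑ i, u i y) x := by
  have : MDifferentiableAt (𝓡 k) 𝓘(ℝ, E) (∑ i, u i) x := MDifferentiableAt.sum fun i _ => hu i
  simpa only [Finset.sum_fn] using this

/-- The family need not be independent. A linear right inverse `R` of the combination map at `x`
gives operators S y = Σ Rᵢ(·) eᵢ(y) with S x = 1. Near `x` they are invertible, and Rᵢ(S⁻¹u) are the
coefficients. -/
theorem exists_mdifferentiableAt_coeff {k : ℕ} {M : Type*} [TopologicalSpace M]
    [ChartedSpace (EuclideanSpace ℝ (Fin k)) M] {x : M} {E : Type*} [NormedAddCommGroup E]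
    [NormedSpace ℝ E] [FiniteDimensional ℝ E] {ι : Type} [Fintype ι] {e : ι → M → E}
    (he : ∀ i, MDifferentiableAt (𝓡 k) 𝓘(ℝ, E) (e i) x)
    (hspan : Submodule.span ℝ (Set.range fun i => e i x) = ⊤) {u : M → E}
    (hu : MDifferentiableAt (𝓡 k) 𝓘(ℝ, E) u x) :
    ∃ c : ι → M → ℝ, (∀ i, MDifferentiableAt (𝓡 k) 𝓘(ℝ, ℝ) (c i) x) ∧
      ∀ᶠ y in 𝓝 x, u y = ∑ i, c i y • e i y := by
  have : CompleteSpace E := FiniteDimensional.complete ℝ E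
  have hsurj : Function.Surjective (Fintype.linearCombination ℝ fun i => e i x) := by
    intro v
    have hv : v ∈ Submodule.span ℝ (Set.range fun i => e i x) := hspan ▸ Submodule.mem_top
    obtain ⟨c, hc⟩ := (Submodule.mem_span_range_iff_exists_fun ℝ).1 hv
    exact ⟨c, hc⟩
  obtain ⟨R, hR⟩ := LinearMap.exists_rightInverse_of_surjective _ (LinearMap.range_eq_top.2 hsurj)
  let R' : ι → E →L[ℝ] ℝ := fun i => (LinearMap.proj i ∘ₗ R).toContinuousLinearMap
  let S : M → E →L[ℝ] E := fun y => ∑ i, ContinuousLinearMap.smulRightL ℝ E E (R' i) (e i y)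
  have hSapply : ∀ y v, S y v = ∑ i, R' i v • e i y := by
    intro y v
    simp [S]
  have hS : MDifferentiableAt (𝓡 k) 𝓘(ℝ, E →L[ℝ] E) S x :=
    mdifferentiableAt_fun_sum fun i =>
      (ContinuousLinearMap.differentiableAt _).mdifferentiableAt.comp x (he i)
  have hSx : S x = 1 := by
    ext v
    rw [hSapply]
    exact congr($hR v)
  have hunit : IsUnit (S x) := hSx ▸ isUnit_one
  have hinv : MDifferentiableAt (𝓡 k) 𝓘(ℝ, E →L[ℝ] E) (fun y => Ring.inverse (S y)) x :=
    (differentiableAt_inverse hunit).mdifferentiableAt.comp x hS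
  refine ⟨fun i y => R' i (Ring.inverse (S y) (u y)), fun i =>
    (R' i).differentiableAt.mdifferentiableAt.comp x (hinv.clm_apply hu), ?_⟩
  filter_upwards [hS.continuousAt (Units.isOpen.mem_nhds hunit)] with y hy
  rw [← hSapply]
  exact congr($(Ring.mul_inverse_cancel _ hy) (u y)).symm

variable {k d : ℕ}
  {M : Type*} [TopologicalSpace M] [ChartedSpace (EuclideanSpace ℝ (Fin k)) M]
  {N : Type*} [TopologicalSpace N] [ChartedSpace (EuclideanSpace ℝ (Fin d)) N]
  [IsManifold (𝓡 d) ∞ N]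
  {φ : M → N} {V : ∀ x, Tan d (φ x)} {x : M}

/-- A linear bundle map is differentiable if it is so on a spanning family of sections. -/
theorem MDiffAlongAt.linearMap_of_span {ι : Type} [Fintype ι] {e : ι → ∀ y, Tan d (φ y)}
    (he : ∀ i, MDiffAlongAt (k := k) φ (e i) x)
    (hspan : Submodule.span ℝ (Set.range fun i => e i x) = ⊤)
    (P : ∀ y, Tan d (φ y) →ₗ[ℝ] Tan d (φ y))
    (hP : ∀ i, MDiffAlongAt (k := k) φ (fun y => P y (e i y)) x)
    (hV : MDiffAlongAt (k := k) φ V x) :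
    MDiffAlongAt (k := k) φ (fun y => P y (V y)) x := by
  have hspan' : Submodule.span ℝ (Set.range fun i => coord (φ x) (e i x)) = ⊤ := by
    have := congr(Submodule.map (coordEquiv (φ x)).toLinearMap $hspan)
    rw [Submodule.map_span, ← Set.range_comp, Submodule.map_top] at this
    exact this.trans (coordEquiv (φ x)).toLinearEquiv.range
  obtain ⟨c, hc, hu⟩ := exists_mdifferentiableAt_coeff (fun i => (mdiffAlongAt_iff.1 (he i)).2)
    hspan' (mdiffAlongAt_iff.1 hV).2
  have hφ := (mdiffAlongAt_iff.1 hV).1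
  refine mdiffAlongAt_iff.2 ⟨hφ, ?_⟩
  have hs : MDifferentiableAt (𝓡 k) 𝓘(ℝ, EuclideanSpace ℝ (Fin d))
      (fun y => ∑ i, c i y • coord (φ x) (P y (e i y))) x :=
    mdifferentiableAt_fun_sum fun i => (hc i).smul (mdiffAlongAt_iff.1 (hP i)).2
  refine hs.congr_of_eventuallyEq ?_
  filter_upwards [hu, MDiffAlongAt.eventually_mem_baseSet hφ] with y hy hb
  have h1 : V y = ∑ i, c i y • e i y := by
    refine coord_injective hb ?_
    rw [hy, coord_sum hb]
    simp only [coord_smul hb]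
  rw [h1, map_sum, coord_sum hb]
  simp only [map_smul, coord_smul hb]

theorem MDiffAlongAt.dmap [IsManifold (𝓡 k) ∞ M] (hφ : ContMDiff (𝓡 k) (𝓡 d) ∞ φ)
    {Y : ∀ y : M, Tan k y}
    (hY : MDifferentiableAt (𝓡 k) (𝓡 k).tangent
      (fun y => (⟨y, Y y⟩ : TangentBundle (𝓡 k) M)) x) :
    MDiffAlongAt (k := k) φ (fun y => dmap (k := k) (d := d) φ y (Y y)) x :=
  ((hφ.contMDiff_tangentMap (m := 1) (by simpa [one_add_one_eq_two] using
    ENat.LEInfty.out)).mdifferentiable (by simp) _).comp x hY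

theorem SmoothAlongOn.mdiffAlongAt {U : Set M} (h : SmoothAlongOn (k := k) φ V U)
    (hU : U ∈ 𝓝 x) : MDiffAlongAt (k := k) φ V x :=
  (h.contMDiffAt hU).mdifferentiableAt (by simp)

theorem MDiffAlongAt.zero (hφ : MDifferentiableAt (𝓡 k) (𝓡 d) φ x) :
    MDiffAlongAt (k := k) (d := d) φ (fun _ => 0) x := by
  refine mdiffAlongAt_iff.2 ⟨hφ, mdifferentiableAt_const (c := 0) |>.congr_of_eventuallyEq ?_⟩
  filter_upwards [MDiffAlongAt.eventually_mem_baseSet hφ] with y hy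
  rw [← continuousLinearMapAt_eq_coord hy, map_zero]

end Frames

/-! ### Differentiability of the tangential projection. -/

namespace LightlikeSubmanifold

variable {k d : ℕ}
  {M : Type*} [TopologicalSpace M] [ChartedSpace (EuclideanSpace ℝ (Fin k)) M]
  [IsManifold (𝓡 k) ∞ M]
  {N : Type*} [TopologicalSpace N] [ChartedSpace (EuclideanSpace ℝ (Fin d)) N]
  [IsManifold (𝓡 d) ∞ N]
  {g : SemiRiemannianMetric d N} (L : LightlikeSubmanifold k M g)

theorem tangPart_dmap (x : M) (v : Tan k x) :
    L.tangPart x (dmap (k := k) (d := d) L.φ x v) = v := by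
  have h : (tangentRange (k := k) L.φ x).projectionOnto (L.ltr x ⊔ L.SP x) (L.isCompl_tangent_tr x)
      (dmap (k := k) (d := d) L.φ x v) = LinearEquiv.ofInjective
        (dmap (k := k) (d := d) L.φ x).toLinearMap (L.immersion x) v :=
    Submodule.projectionOnto_apply_left (L.isCompl_tangent_tr x)
      (LinearEquiv.ofInjective (dmap (k := k) (d := d) L.φ x).toLinearMap (L.immersion x) v)
  exact (congrArg _ h).trans (LinearEquiv.symm_apply_apply _ _)

theorem tangPart_of_mem {x : M} {u : Tan d (L.φ x)} (hu : u ∈ L.ltr x ⊔ L.SP x) :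
    L.tangPart x u = 0 := by
  have h : (tangentRange (k := k) L.φ x).projectionOnto (L.ltr x ⊔ L.SP x) (L.isCompl_tangent_tr x)
      u = 0 := (Submodule.projectionOnto_apply_eq_zero_iff (L.isCompl_tangent_tr x)).2 hu
  exact (congrArg (LinearEquiv.ofInjective
    (dmap (k := k) (d := d) L.φ x).toLinearMap (L.immersion x)).symm h).trans (map_zero _)

/-- The tangential part of a differentiable vector field along the submanifold is differentiable. -/
theorem mdiffAlongAt_dmap_tangPart {V : ∀ x, Tan d (L.φ x)} {x : M}
    (hV : MDiffAlongAt (k := k) L.φ V x) :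
    MDiffAlongAt (k := k) L.φ (fun y => dmap (k := k) (d := d) L.φ y (L.tangPart y (V y))) x := by
  obtain ⟨U, hU, s, hs, hs'⟩ := L.ltr_smooth x
  obtain ⟨n, hn⟩ := L.SP_smooth
  obtain ⟨U', hU', t, ht, ht'⟩ := hn x
  -- The family is adapted to TM ⊕ ltr ⊕ S(TM^⊥): the projection fixes its first block and kills the
  -- other two. Spanning at `x` alone is enough.
  let b := (EuclideanSpace.basisFun (Fin k) ℝ).toBasis.map (coordEquiv x).symm.toLinearEquiv
  let X : Fin k → ∀ y : M, Tan k y := fun i => FiberBundle.extend (EuclideanSpace ℝ (Fin k)) (b i)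
  let e : Fin k ⊕ Fin L.r ⊕ Fin n → ∀ y, Tan d (L.φ y) :=
    Sum.elim (fun i y => dmap (k := k) L.φ y (X i y)) (Sum.elim s t)
  have hX : ∀ i, MDiffAlongAt (k := k) L.φ (fun y => dmap (k := k) (d := d) L.φ y (X i y)) x := fun i =>
    .dmap L.smooth (mdifferentiableAt_extend (b i))
  have hzero : ∀ W : ∀ y, Tan d (L.φ y), (∀ᶠ y in 𝓝 x, W y ∈ L.ltr y ⊔ L.SP y) →
      MDiffAlongAt (k := k) L.φ (fun y => dmap (k := k) (d := d) L.φ y (L.tangPart y (W y))) x := by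
    intro W hW
    refine MDifferentiableAt.congr_of_eventuallyEq
      (MDiffAlongAt.zero (L.smooth.mdifferentiable (by simp) x)) ?_
    filter_upwards [hW] with y hy
    rw [L.tangPart_of_mem hy, map_zero]
  have hspan : Submodule.span ℝ (Set.range fun i => e i x) = ⊤ := by
    have h1 : (Set.range fun i => e i x) = Set.range (fun i => dmap (k := k) (d := d) L.φ x (X i x)) ∪
        (Set.range (fun i => s i x) ∪ Set.range fun i => t i x) := by
      rw [← Set.Sum.elim_range, ← Set.Sum.elim_range]
      congr 1
      funext i
      rcases i with i | i | i <;> rfl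
    have h2 : Submodule.span ℝ (Set.range fun i => dmap (k := k) (d := d) L.φ x (X i x)) =
        tangentRange (k := k) (d := d) L.φ x := by
      have hX : (fun i => X i x) = b := by
        funext i; exact FiberBundle.extend_apply_self _ _
      rw [tangentRange, LinearMap.range_eq_map, ← b.span_eq, Submodule.map_span, ← Set.range_comp,
        ← hX]
      rfl
    rw [h1, Submodule.span_union, Submodule.span_union, h2, (hs' x (mem_of_mem_nhds hU)).2,
      (ht' x (mem_of_mem_nhds hU')).2]
    exact (L.isCompl_tangent_tr x).sup_eq_top
  refine MDiffAlongAt.linearMap_of_span (e := e) ?_ hspan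
    (fun y => (dmap (k := k) (d := d) L.φ y).toLinearMap ∘ₗ L.tangPart y) ?_ hV
  · rintro (i | i | i)
    · exact hX i
    · exact (hs i).mdiffAlongAt hU
    · exact (ht i).mdiffAlongAt hU'
  · rintro (i | i | i)
    · have : (fun y => ((dmap (k := k) (d := d) L.φ y).toLinearMap ∘ₗ L.tangPart y) (e (.inl i) y)) =
          fun y => dmap (k := k) (d := d) L.φ y (X i y) := by
        funext y
        exact congrArg (dmap (k := k) (d := d) L.φ y) (L.tangPart_dmap y (X i y))
      rw [this]
      exact hX i
    · refine hzero (s i) ?_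
      filter_upwards [hU] with y hy
      refine Submodule.mem_sup_left ?_
      rw [← (hs' y hy).2]
      exact Submodule.subset_span ⟨i, rfl⟩
    · refine hzero (t i) ?_
      filter_upwards [hU'] with y hy
      refine Submodule.mem_sup_right ?_
      rw [← (ht' y hy).2]
      exact Submodule.subset_span ⟨i, rfl⟩

end LightlikeSubmanifold
end LightlikeGeometry
end

/-! ### The structure equation for the bracket. -/

noncomputable section

namespace LightlikeGeometry
namespace LightlikeSubmanifold

variable {k d : ℕ}
  {M : Type*} [TopologicalSpace M] [ChartedSpace (EuclideanSpace ℝ (Fin k)) M]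
  [IsManifold (𝓡 k) ∞ M]
  {N : Type*} [TopologicalSpace N] [ChartedSpace (EuclideanSpace ℝ (Fin d)) N]
  [IsManifold (𝓡 d) ∞ N]
  {g : SemiRiemannianMetric d N} (L : LightlikeSubmanifold k M g)
  {J : BronzeStructure g} {nabla : LinearConnection d N} {c : LMData g}
  {Y Z : ∀ x : M, Tan k x} {x : M}

theorem dmap_f_add_w (J : BronzeStructure g) (x : M) (v : Tan k x) :
    dmap (k := k) (d := d) L.φ x (L.f J x v) + L.w J x v =
      J.J (L.φ x) (dmap (k := k) (d := d) L.φ x v) :=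
  add_sub_cancel _ _

theorem tangPart_lm (J : BronzeStructure g) (x : M) (v : Tan k x) (a b : ℝ) :
    L.tangPart x (a • dmap (k := k) (d := d) L.φ x v +
      b • J.J (L.φ x) (dmap (k := k) (d := d) L.φ x v)) = a • v + b • L.f J x v := by
  rw [map_add, map_smul, map_smul, tangPart_dmap]
  rfl

theorem induced_lmConnection (c : LMData g) (Y : ∀ x : M, Tan k x) (x : M) (v : Tan k x) :
    L.induced (lmConnection nabla J c) Y x v = L.induced nabla Y x v +
      c.θ (L.φ x) (dmap (k := k) (d := d) L.φ x (Y x)) •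
        (c.l (L.φ x) • v + c.m (L.φ x) • L.f J x v) := by
  unfold induced
  rw [covAlong_lmConnection, map_add, map_smul, tangPart_lm]

/-- `Ω_v fY - A_{wY} v`, the tangential part of `Ω_v JY`. -/
theorem induced_f_sub_shape_w (hJ : J.IsParallel nabla) (c : LMData g)
    (hY : MDifferentiableAt (𝓡 k) (𝓡 k).tangent
      (fun y => (⟨y, Y y⟩ : TangentBundle (𝓡 k) M)) x) (v : Tan k x) :
    L.induced (lmConnection nabla J c) (fun y => L.f J y (Y y)) x v -
      L.shape (lmConnection nabla J c) (fun y => L.w J y (Y y)) x v =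
    L.tangPart x (J.J (L.φ x) (covAlong nabla L.φ
      (fun y => dmap (k := k) (d := d) L.φ y (Y y)) x v)) +
      c.θ (L.φ x) (J.J (L.φ x) (dmap (k := k) (d := d) L.φ x (Y x))) •
        (c.l (L.φ x) • v + c.m (L.φ x) • L.f J x v) := by
  have h0 : MDiffAlongAt (k := k) L.φ (fun y => dmap (k := k) (d := d) L.φ y (Y y)) x :=
    .dmap L.smooth hY
  have h1 : MDiffAlongAt (k := k) L.φ (fun y => dmap (k := k) (d := d) L.φ y (L.f J y (Y y))) x :=
    L.mdiffAlongAt_dmap_tangPart (h0.J J)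
  have h2 : MDiffAlongAt (k := k) L.φ (fun y => L.w J y (Y y)) x := (h0.J J).sub h1
  unfold induced shape
  -- The sign in the shape operator makes the left side the tangential part of the derivative of fY
  -- + wY = JY.
  rw [sub_neg_eq_add, ← map_add, ← covAlong_add _ h1 h2]
  simp only [dmap_f_add_w]
  rw [covAlong_lmConnection, covAlong_J hJ h0, map_add, map_smul, tangPart_lm]

/-- The antisymmetrised structure equation: up to sections of `B'`, the vector field of the
integrability conditions is `f [Y, Z] - 3 [Y, Z]`. -/
theorem exists_structure_equation {Bp : ∀ x : M, Submodule ℝ (Tan k x)}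
    (hLC : IsLeviCivita g nabla) (hJ : J.IsParallel nabla) (c : LMData g)
    (hB : L.IsScreenGeneric J Bp) (hY : IsSectionOf Bp Y) (hZ : IsSectionOf Bp Z) (x : M) :
    ∃ s ∈ Bp x,
      L.induced (lmConnection nabla J c) (fun y => L.f J y (Z y)) x (Y x)
        + L.shape (lmConnection nabla J c) (fun y => L.w J y (Y y)) x (Z x)
        + (3 : ℝ) • L.induced (lmConnection nabla J c) Y x (Z x)
        - L.induced (lmConnection nabla J c) (fun y => L.f J y (Y y)) x (Z x)
        - L.shape (lmConnection nabla J c) (fun y => L.w J y (Z y)) x (Y x)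
        - (3 : ℝ) • L.induced (lmConnection nabla J c) Z x (Y x) =
      L.f J x (VectorField.mlieBracket (𝓡 k) Y Z x)
        - (3 : ℝ) • VectorField.mlieBracket (𝓡 k) Y Z x + s := by
  have hY' := (hY.1.mdiffAlongAt Filter.univ_mem : MDiffAlongAt (k := k) _ _ x)
  have hZ' := (hZ.1.mdiffAlongAt Filter.univ_mem : MDiffAlongAt (k := k) _ _ x)
  have e1 := L.induced_f_sub_shape_w hJ c hZ' (Y x)
  have e2 := L.induced_f_sub_shape_w hJ c hY' (Z x)
  have e3 := L.induced_lmConnection (nabla := nabla) (J := J) c Y x (Z x)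
  have e4 := L.induced_lmConnection (nabla := nabla) (J := J) c Z x (Y x)
  have t := covAlong_dmap_sub hLC.torsion_eq_zero L.smooth hY' hZ'
  have t1 : L.induced nabla Z x (Y x) - L.induced nabla Y x (Z x) =
      VectorField.mlieBracket (𝓡 k) Y Z x := by
    unfold induced
    rw [← map_sub, t, tangPart_dmap]
  have t2 : L.tangPart x (J.J (L.φ x) (covAlong nabla L.φ
        (fun y => dmap (k := k) (d := d) L.φ y (Z y)) x (Y x))) -
      L.tangPart x (J.J (L.φ x) (covAlong nabla L.φ
        (fun y => dmap (k := k) (d := d) L.φ y (Y y)) x (Z x))) =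
      L.f J x (VectorField.mlieBracket (𝓡 k) Y Z x) := by
    rw [← map_sub, ← map_sub, t]
    rfl
  set α := c.θ (L.φ x) (J.J (L.φ x) (dmap (k := k) (d := d) L.φ x (Z x)))
  set β := c.θ (L.φ x) (J.J (L.φ x) (dmap (k := k) (d := d) L.φ x (Y x)))
  set γ := c.θ (L.φ x) (dmap (k := k) (d := d) L.φ x (Y x))
  set δ := c.θ (L.φ x) (dmap (k := k) (d := d) L.φ x (Z x))
  have hmem : ∀ v ∈ Bp x, c.l (L.φ x) • v + c.m (L.φ x) • L.f J x v ∈ Bp x := fun v hv =>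
    add_mem (Submodule.smul_mem _ _ hv) (Submodule.smul_mem _ _ (hB.f_mem x v hv))
  -- The coefficients collect the θ-terms of `e1` − `e2` + 3 `e3` − 3 `e4`: `e1` and `e4` contribute
  -- along `Y`, `e2` and `e3` along `Z`.
  refine ⟨(α - 3 * δ) • (c.l (L.φ x) • Y x + c.m (L.φ x) • L.f J x (Y x)) +
    (3 * γ - β) • (c.l (L.φ x) • Z x + c.m (L.φ x) • L.f J x (Z x)),
    add_mem (Submodule.smul_mem _ _ (hmem _ (hY.2 x)))
      (Submodule.smul_mem _ _ (hmem _ (hZ.2 x))), ?_⟩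
  rw [← t2, ← t1]
  rw [sub_eq_iff_eq_add.1 e1, sub_eq_iff_eq_add.1 e2, e3, e4]
  module

/-! ### Linear algebra of the screen generic decomposition, and the pointwise criterion. -/

section Algebra

variable {Bp : ∀ x : M, Submodule ℝ (Tan k x)}

theorem IsScreenGeneric.Bp_le (hB : L.IsScreenGeneric J Bp) (x : M) : Bp x ≤ L.S x :=
  hB.Bo_sup_Bp x ▸ le_sup_right

theorem f_eq_of_dmap_eq {v w : Tan k x} (h : J.J (L.φ x) (dmap (k := k) (d := d) L.φ x v) =
    dmap (k := k) (d := d) L.φ x w) : L.f J x v = w := by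
  unfold f
  rw [h, tangPart_dmap]

/-- `B_o` is invariant under `J`, and so under `J⁻¹ = J - 3`. -/
theorem f_mem_Bo {a : Tan k x} (ha : a ∈ L.Bo J x) :
    L.f J x a ∈ L.Bo J x ∧ J.J (L.φ x) (dmap (k := k) (d := d) L.φ x a) =
      dmap (k := k) (d := d) L.φ x (L.f J x a) := by
  obtain ⟨⟨_, ⟨s, hs, rfl⟩, h⟩, haS⟩ := ha
  have h' : J.J (L.φ x) (dmap (k := k) (d := d) L.φ x s) = dmap (k := k) (d := d) L.φ x a := h
  -- If a = Js with s in S(TM), then Ja = J²s = 3a + s is again in S(TM).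
  have e : J.J (L.φ x) (dmap (k := k) (d := d) L.φ x a) =
      dmap (k := k) (d := d) L.φ x ((3 : ℝ) • a + s) := by
    rw [← h', J.sq, h', map_add, map_smul]
  have hf := L.f_eq_of_dmap_eq e
  rw [hf]
  refine ⟨⟨⟨_, ⟨a, haS, rfl⟩, e⟩, add_mem (Submodule.smul_mem _ _ haS) hs⟩, e⟩

theorem IsScreenGeneric.f_mem_radical (hB : L.IsScreenGeneric J Bp) {ρ : Tan k x}
    (hρ : ρ ∈ radical (k := k) g L.φ x) :
    L.f J x ρ ∈ radical (k := k) g L.φ x ∧ J.J (L.φ x) (dmap (k := k) (d := d) L.φ x ρ) =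
      dmap (k := k) (d := d) L.φ x (L.f J x ρ) := by
  have h : J.J (L.φ x) (dmap (k := k) (d := d) L.φ x ρ) ∈
      push L.φ x (radical (k := k) g L.φ x) := by
    rw [← hB.radical_invariant x]
    exact ⟨_, ⟨ρ, hρ, rfl⟩, rfl⟩
  obtain ⟨σ, hσ, e⟩ := h
  have hf := L.f_eq_of_dmap_eq e.symm
  rw [hf]
  exact ⟨hσ, e.symm⟩

theorem ltr_le (x : M) : L.ltr x ≤ orth g (push L.φ x (L.S x)) ⊓ orth g (L.SP x) :=
  L.radical_sup_ltr x ▸ le_sup_right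

theorem val_dmap_S_ltr {s : Tan k x} (hs : s ∈ L.S x) {n : Tan d (L.φ x)} (hn : n ∈ L.ltr x) :
    g.val (L.φ x) (dmap (k := k) (d := d) L.φ x s) n = 0 := by
  rw [g.symm]
  exact (L.ltr_le x hn).1 _ ⟨s, hs, rfl⟩

/-- `J(S(TM))` is orthogonal to `ltr(TM)`. -/
theorem IsScreenGeneric.val_J_S_ltr (hB : L.IsScreenGeneric J Bp) {s : Tan k x} (hs : s ∈ L.S x)
    {n : Tan d (L.φ x)} (hn : n ∈ L.ltr x) :
    g.val (L.φ x) (dmap (k := k) (d := d) L.φ x s) (J.J (L.φ x) n) = 0 := by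
  rw [← hB.Bo_sup_Bp x] at hs
  obtain ⟨a, ha, b, hb, rfl⟩ := Submodule.mem_sup.1 hs
  -- Self-adjointness moves `J` to the tangent side: Ja stays in S(TM), while Jb = fb + wb lies in
  -- S(TM) + S(TM^⊥). Both are orthogonal to `ltr`.
  have h1 : g.val (L.φ x) (dmap (k := k) (d := d) L.φ x a) (J.J (L.φ x) n) = 0 := by
    rw [J.compatible, (L.f_mem_Bo ha).2]
    exact L.val_dmap_S_ltr (L.f_mem_Bo ha).1.2 hn
  have h2 : g.val (L.φ x) (dmap (k := k) (d := d) L.φ x b) (J.J (L.φ x) n) = 0 := by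
    rw [J.compatible, ← L.dmap_f_add_w, map_add, _root_.add_apply,
      L.val_dmap_S_ltr (hB.Bp_le L x (hB.f_mem x b hb)) hn, g.symm,
      (L.ltr_le x hn).2 _ (hB.w_mem x b hb), add_zero]
  rw [map_add, map_add, _root_.add_apply, h1, h2, add_zero]

/-- `Rad TM` and `ltr(TM)` are in duality. -/
theorem eq_zero_of_forall_val_ltr {ρ : Tan k x} (hρ : ρ ∈ radical (k := k) g L.φ x)
    (h : ∀ n ∈ L.ltr x, g.val (L.φ x) (dmap (k := k) (d := d) L.φ x ρ) n = 0) : ρ = 0 := by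
  have hT : ∀ u ∈ tangentRange (k := k) (d := d) L.φ x,
      g.val (L.φ x) (dmap (k := k) (d := d) L.φ x ρ) u = 0 := hρ
  have hSP : ∀ u ∈ L.SP x, g.val (L.φ x) (dmap (k := k) (d := d) L.φ x ρ) u = 0 := by
    intro u hu
    have : u ∈ orth g (tangentRange (k := k) L.φ x) := by
      rw [← L.radical_sup_SP x]
      exact Submodule.mem_sup_right hu
    rw [g.symm]
    exact this _ ⟨ρ, rfl⟩
  refine L.immersion x ?_
  rw [map_zero]
  -- A radical vector is already orthogonal to TM and to S(TM^⊥), so `ltr` is the only summand left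
  -- to test.
  refine g.nondegenerate _ _ fun v => ?_
  have hv : v ∈ tangentRange (k := k) L.φ x ⊔ (L.ltr x ⊔ L.SP x) :=
    (L.isCompl_tangent_tr x).sup_eq_top ▸ Submodule.mem_top
  obtain ⟨t, ht, w, hw, rfl⟩ := Submodule.mem_sup.1 hv
  obtain ⟨n, hn, s, hs, rfl⟩ := Submodule.mem_sup.1 hw
  rw [map_add, map_add, hT t ht, h n hn, hSP s hs, add_zero, add_zero]

/-- A tangent vector `v` lies in `B'` if and only if the tangential part of `J⁻¹ v = J v - 3 v` has
no component in `B_o` and is orthogonal to `J(ltr(TM))`. -/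
theorem IsScreenGeneric.mem_Bp_iff (hB : L.IsScreenGeneric J Bp) (v : Tan k x) :
    v ∈ Bp x ↔ hB.projBo x (L.f J x v - (3 : ℝ) • v) = 0 ∧
      ∀ n ∈ L.ltr x, g.val (L.φ x)
        (dmap (k := k) (d := d) L.φ x (L.f J x v - (3 : ℝ) • v)) (J.J (L.φ x) n) = 0 := by
  have hBp : ∀ b ∈ Bp x, L.f J x b - (3 : ℝ) • b ∈ Bp x := fun b hb =>
    sub_mem (hB.f_mem x b hb) (Submodule.smul_mem _ _ hb)
  have hker : ∀ u, hB.projBo x u = 0 ↔ u ∈ Bp x ⊔ radical (k := k) g L.φ x := fun u =>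
    Submodule.projection_apply_eq_zero_iff (hB.isCompl_Bo x)
  constructor
  · intro hv
    exact ⟨(hker _).2 (Submodule.mem_sup_left (hBp v hv)),
      fun n hn => hB.val_J_S_ltr L (hB.Bp_le L x (hBp v hv)) hn⟩
  · rintro ⟨h1, h2⟩
    have hv : v ∈ L.Bo J x ⊔ (Bp x ⊔ radical (k := k) g L.φ x) :=
      (hB.isCompl_Bo x).sup_eq_top ▸ Submodule.mem_top
    obtain ⟨a, ha, w, hw, rfl⟩ := Submodule.mem_sup.1 hv
    obtain ⟨b, hb, ρ, hρ, rfl⟩ := Submodule.mem_sup.1 hw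
    have hfadd : ∀ u u', L.f J x (u + u') = L.f J x u + L.f J x u' := by
      intro u u'; unfold f; rw [map_add, map_add, map_add]
    have hfa := L.f_mem_Bo ha
    have hfρ := hB.f_mem_radical L hρ
    have e : L.f J x (a + (b + ρ)) - (3 : ℝ) • (a + (b + ρ)) =
        (L.f J x a - (3 : ℝ) • a) + ((L.f J x b - (3 : ℝ) • b) + (L.f J x ρ - (3 : ℝ) • ρ)) := by
      rw [hfadd, hfadd]; module
    have hfρ' : L.f J x ρ - (3 : ℝ) • ρ ∈ radical (k := k) g L.φ x :=
      sub_mem hfρ.1 (Submodule.smul_mem _ _ hρ)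
    have hfa' : L.f J x a - (3 : ℝ) • a ∈ L.Bo J x :=
      sub_mem hfa.1 (Submodule.smul_mem _ _ ha)
    rw [e] at h1 h2
    -- The three summands are preserved separately, so the `B_o` condition involves only `a`.
    have ha0 : L.f J x a - (3 : ℝ) • a = 0 := by
      have h3 : hB.projBo x ((L.f J x b - (3 : ℝ) • b) + (L.f J x ρ - (3 : ℝ) • ρ)) = 0 :=
        (hker _).2 (Submodule.add_mem_sup (hBp b hb) hfρ')
      rw [map_add, h3, add_zero] at h1
      have h4 : hB.projBo x (L.f J x a - (3 : ℝ) • a) = L.f J x a - (3 : ℝ) • a :=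
        Submodule.projection_apply_of_mem_left (hB.isCompl_Bo x) hfa'
      exact h4.symm.trans h1
    -- Ja = 3a and J² = 3J + 1 give 9a = 9a + a.
    have ha1 : a = 0 := by
      refine L.immersion x ?_
      have h3 : J.J (L.φ x) (dmap (k := k) (d := d) L.φ x a) =
          (3 : ℝ) • dmap (k := k) (d := d) L.φ x a := by
        rw [hfa.2, sub_eq_zero.1 ha0, map_smul]
      have h4 := J.sq (L.φ x) (dmap (k := k) (d := d) L.φ x a)
      rw [h3, map_smul, h3] at h4
      rw [map_zero]
      exact left_eq_add.1 h4
    -- Here g(Jρ − 3ρ, Jn) = g(J²ρ − 3Jρ, n) = g(ρ, n), and the duality with `ltr` applies.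
    have hρ0 : ρ = 0 := by
      refine L.eq_zero_of_forall_val_ltr hρ fun n hn => ?_
      have h3 := h2 n hn
      rw [ha0, zero_add, map_add, map_add, _root_.add_apply,
        hB.val_J_S_ltr L (hB.Bp_le L x (hBp b hb)) hn, zero_add, J.compatible, map_sub, ← hfρ.2,
        map_sub, J.sq, map_smul, map_smul, add_sub_cancel_left] at h3
      exact h3
    rw [ha1, hρ0, zero_add, add_zero]
    exact hb

/-- The pointwise form of the integrability criterion. -/
theorem mlieBracket_mem_iff (hLC : IsLeviCivita g nabla) (hJ : J.IsParallel nabla) (c : LMData g)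
    (hB : L.IsScreenGeneric J Bp) (hY : IsSectionOf Bp Y) (hZ : IsSectionOf Bp Z) (x : M) :
    VectorField.mlieBracket (𝓡 k) Y Z x ∈ Bp x ↔
      hB.projBo x
          (L.screenConn (lmConnection nabla J c) (fun y => L.f J y (Z y)) x (Y x)
            + L.shape (lmConnection nabla J c) (fun y => L.w J y (Y y)) x (Z x)
            + (3 : ℝ) • L.screenConn (lmConnection nabla J c) Y x (Z x)
            - L.screenConn (lmConnection nabla J c) (fun y => L.f J y (Y y)) x (Z x)
            - L.shape (lmConnection nabla J c) (fun y => L.w J y (Z y)) x (Y x)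
            - (3 : ℝ) • L.screenConn (lmConnection nabla J c) Z x (Y x)) = 0 ∧
        ∀ n ∈ L.ltr x,
          g.val (L.φ x) (dmap L.φ x
            (L.shape (lmConnection nabla J c) (fun y => L.w J y (Y y)) x (Z x)
              + L.hStar (lmConnection nabla J c) (fun y => L.f J y (Z y)) x (Y x)
              + (3 : ℝ) • L.hStar (lmConnection nabla J c) Y x (Z x))) (J.J (L.φ x) n)
          = g.val (L.φ x) (dmap L.φ x
            (L.shape (lmConnection nabla J c) (fun y => L.w J y (Z y)) x (Y x)
              + L.hStar (lmConnection nabla J c) (fun y => L.f J y (Y y)) x (Z x)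
              + (3 : ℝ) • L.hStar (lmConnection nabla J c) Z x (Y x))) (J.J (L.φ x) n) := by
  obtain ⟨s, hs, e⟩ := L.exists_structure_equation hLC hJ c hB hY hZ x
  have hdecomp : ∀ X v, L.screenConn (lmConnection nabla J c) X x v =
      L.induced (lmConnection nabla J c) X x v - L.hStar (lmConnection nabla J c) X x v :=
    fun X v => Submodule.projection_eq_self_sub_projection (L.isCompl_radical_S x) _
  have hrad : ∀ X v, L.hStar (lmConnection nabla J c) X x v ∈ radical (k := k) g L.φ x :=
    fun X v => Submodule.projection_apply_mem (L.isCompl_radical_S x) _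
  have hscr : ∀ X v, L.screenConn (lmConnection nabla J c) X x v ∈ L.S x :=
    fun X v => Submodule.projection_apply_mem (L.isCompl_radical_S x).symm _
  rw [hB.mem_Bp_iff L]
  refine and_congr ?_ (forall₂_congr fun n hn => ?_)
  -- Passing from Ω to Ω* changes the field by radical vectors, and `s` lies in `B'`; the `B_o`
  -- projection kills both.
  · have hker : ∀ u, u ∈ Bp x ⊔ radical (k := k) g L.φ x → hB.projBo x u = 0 := fun u =>
      (Submodule.projection_apply_eq_zero_iff (hB.isCompl_Bo x)).2
    have h1 := hker s (Submodule.mem_sup_left hs)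
    have h2 := fun X v => hker _ (Submodule.mem_sup_right (hrad X v))
    rw [eq_sub_of_add_eq e.symm]
    simp only [hdecomp, map_add, map_sub, map_smul, h1, h2, sub_zero]
  · set A₁ := L.shape (lmConnection nabla J c) (fun y => L.w J y (Y y)) x (Z x)
    set A₂ := L.shape (lmConnection nabla J c) (fun y => L.w J y (Z y)) x (Y x)
    set B₁ := L.hStar (lmConnection nabla J c) (fun y => L.f J y (Z y)) x (Y x)
    set B₂ := L.hStar (lmConnection nabla J c) (fun y => L.f J y (Y y)) x (Z x)
    set C₁ := L.hStar (lmConnection nabla J c) Y x (Z x)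
    set C₂ := L.hStar (lmConnection nabla J c) Z x (Y x)
    -- All the terms absent from (ii), namely the Ω* terms and `s`, lie in S(TM), hence are
    -- orthogonal to J(ltr).
    have hσ : L.screenConn (lmConnection nabla J c) (fun y => L.f J y (Z y)) x (Y x)
        - L.screenConn (lmConnection nabla J c) (fun y => L.f J y (Y y)) x (Z x)
        + (3 : ℝ) • L.screenConn (lmConnection nabla J c) Y x (Z x)
        - (3 : ℝ) • L.screenConn (lmConnection nabla J c) Z x (Y x) - s ∈ L.S x :=
      sub_mem (sub_mem (add_mem (sub_mem (hscr _ _) (hscr _ _)) (Submodule.smul_mem _ _ (hscr _ _)))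
        (Submodule.smul_mem _ _ (hscr _ _))) (hB.Bp_le L x hs)
    have h := hB.val_J_S_ltr L hσ hn
    set σ := L.screenConn (lmConnection nabla J c) (fun y => L.f J y (Z y)) x (Y x)
        - L.screenConn (lmConnection nabla J c) (fun y => L.f J y (Y y)) x (Z x)
        + (3 : ℝ) • L.screenConn (lmConnection nabla J c) Y x (Z x)
        - (3 : ℝ) • L.screenConn (lmConnection nabla J c) Z x (Y x) - s with hσdef
    have e' : L.f J x (VectorField.mlieBracket (𝓡 k) Y Z x)
        - (3 : ℝ) • VectorField.mlieBracket (𝓡 k) Y Z x =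
        (A₁ + B₁ + (3 : ℝ) • C₁) - (A₂ + B₂ + (3 : ℝ) • C₂) + σ := by
      rw [eq_sub_of_add_eq e.symm, hσdef, hdecomp, hdecomp, hdecomp, hdecomp]
      module
    rw [e', map_add, map_add, _root_.add_apply, h, add_zero, map_sub, map_sub, _root_.sub_apply,
      sub_eq_zero]

end Algebra

end LightlikeSubmanifold
end LightlikeGeometry
end

theorem mainTheorem5 {k d : ℕ}
    {M : Type*} [TopologicalSpace M] [ChartedSpace (EuclideanSpace ℝ (Fin k)) M]
    [IsManifold (𝓡 k) ∞ M]
    {N : Type*} [TopologicalSpace N] [ChartedSpace (EuclideanSpace ℝ (Fin d)) N]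
    [IsManifold (𝓡 d) ∞ N]
    (g : LightlikeGeometry.SemiRiemannianMetric d N)
    (J : LightlikeGeometry.BronzeStructure g)
    (nabla : LightlikeGeometry.LinearConnection d N)
    (hLC : LightlikeGeometry.IsLeviCivita g nabla)
    (hJ : J.IsParallel nabla)
    (c : LightlikeGeometry.LMData g)
    (Ω : LightlikeGeometry.LinearConnection d N)
    (hΩ : Ω = LightlikeGeometry.lmConnection nabla J c)
    (L : LightlikeGeometry.LightlikeSubmanifold k M g)
    (Bp : ∀ x : M, Submodule ℝ (LightlikeGeometry.Tan k x))
    (hB : L.IsScreenGeneric J Bp) :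
    LightlikeGeometry.IsIntegrable Bp ↔
      ∀ Y Z : ∀ x : M, LightlikeGeometry.Tan k x,
        LightlikeGeometry.IsSectionOf Bp Y → LightlikeGeometry.IsSectionOf Bp Z →
        (∀ x, hB.projBo x
          (L.screenConn Ω (fun y => L.f J y (Z y)) x (Y x)
            + L.shape Ω (fun y => L.w J y (Y y)) x (Z x)
            + (3 : ℝ) • L.screenConn Ω Y x (Z x)
            - L.screenConn Ω (fun y => L.f J y (Y y)) x (Z x)
            - L.shape Ω (fun y => L.w J y (Z y)) x (Y x)
            - (3 : ℝ) • L.screenConn Ω Z x (Y x)) = 0) ∧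
        (∀ x, ∀ n ∈ L.ltr x,
          g.val (L.φ x) (LightlikeGeometry.dmap L.φ x
            (L.shape Ω (fun y => L.w J y (Y y)) x (Z x)
              + L.hStar Ω (fun y => L.f J y (Z y)) x (Y x)
              + (3 : ℝ) • L.hStar Ω Y x (Z x))) (J.J (L.φ x) n)
          = g.val (L.φ x) (LightlikeGeometry.dmap L.φ x
            (L.shape Ω (fun y => L.w J y (Z y)) x (Y x)
              + L.hStar Ω (fun y => L.f J y (Y y)) x (Z x)
              + (3 : ℝ) • L.hStar Ω Z x (Y x))) (J.J (L.φ x) n)) := by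
  subst hΩ
  have key : ∀ Y Z : ∀ x : M, LightlikeGeometry.Tan k x,
      LightlikeGeometry.IsSectionOf Bp Y → LightlikeGeometry.IsSectionOf Bp Z → ∀ x,
      VectorField.mlieBracket (𝓡 k) Y Z x ∈ Bp x ↔ _ := fun Y Z hY hZ x =>
    L.mlieBracket_mem_iff hLC hJ c hB hY hZ x
  constructor
  · intro h Y Z hY hZ
    have := fun x => (key Y Z hY hZ x).1 (h Y Z hY hZ x)
    exact ⟨fun x => (this x).1, fun x => (this x).2⟩
  · intro h Y Z hY hZ x
    exact (key Y Z hY hZ x).2 ⟨(h Y Z hY hZ).1 x, (h Y Z hY hZ).2 x⟩
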